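/- **Setting.** Let $\pi$ be a pair partition of $\mathbb Z/2N$, viewed as a fixed-point-free involution. It gives * a one-face map: glue side $i$ of a $2N$-gon (running from corner $i$ to corner $i+1$) to side $\pi(i)$ with reversed direction; the sides and corners become a graph with $N$ edges embedded in a closed oriented surface. The map has genus zero if the surface has Euler characteristic $2$; * a three-regular multigraph $G_\pi$ on the vertex set $\mathbb Z/2N$: a cycle edge from $i$ to $i+1$ for every $i$, and one further edge joining $i$ and $\pi(i)$ for every pair. It is drawn with the cycle as a circle and the other edges inside it (given by the corresponding rotation system). Let $\mathcal X_N$ be the set of the graphs $G_\pi$ with $\pi$ of genus zero, with the uniform probability, and $\mathbb E$ the expectation over $\mathcal X_N$. For a multigraph $X$ let $|X|$ be the number of vertices, $w_r(X)$ the number of closed walks of length $r$, and $c_r(X)$ the number of cycles of length $r$ (a pair of parallel edges is a $2$-cycle). The McKay density for degree $3$ is $f_3(x)=\dfrac{3\sqrt{8-x^2}}{2\pi(9-x^2)}$ for $|x|\le 2\sqrt2$ and $f_3(x)=0$ otherwise. "Limiting density" refers to weak convergence of the empirical eigenvalue distributions of the adjacency matrices. **Statement.** 1. The adjacency matrices of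 the graphs $G_\pi$ are exactly the matrices $C+P^TTP$, where $C$ is the adjacency matrix of the cycle graph on $2N$ vertices, $T$ that of the standard toothpick graph (first vertex adjacent to the second, third to the fourth, and so on) and $P$ is a permutation matrix; distinct pair partitions have distinct adjacency matrices. 2. Let $\pi$ have genus zero. Then the embedded graph is a tree, $G_\pi$ is three-regular, and the drawing of $G_\pi$ satisfies Euler's formula for the plane. There is a bijection from the internal faces of the drawing to the vertices of the tree, sending the internal face along the cycle edge from $i$ to $i+1$ to the vertex that is the image of corner $i+1$. If a face corresponds to a vertex of degree $d$, its boundary has length $2d$ and is a $2d$-cycle of $G_\pi$. Hence for every $d$ the number of vertices of degree $d$ in the tree is at most $c_{2d}(G_\pi)$. 3. For every $k\ge1$ the expected number of vertices of degree $k$ in the tree of a uniformly random genus-zero one-face map with $N$ edges is asymptotic to $N/2^k$ as $N\to\infty$. 4. For every $k\ge 1$ the expected number of $2k$-cycles is asymptotically at least $N/2^k$: $$\liminf_{N\to\infty}\frac{\mathbb E(c_{2k})}{N/2^k}\ge 1 .$$ 5. For every $k\ge1$ and every $\delta<2^{-(k+1)}$ there are $\varepsilon>0$ and subsets $S_N\subseteq\mathcal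 X_N$, with $|S_N|/|\mathcal X_N|\ge\varepsilon$ for all large $N$, such that every $X\in S_N$ satisfies $$\frac{w_{2k}(X)}{|X|}\ \ge\ \frac{c_{2k}(X)}{2N}\ \ge\ \delta .$$ 6. McKay's hypothesis fails with probability bounded away from zero: there are $\varepsilon>0$ and subsets $S_N\subseteq\mathcal X_N$, with $|S_N|/|\mathcal X_N|\ge\varepsilon$ for all large $N$, such that for all $N_j\to\infty$ and $X_j\in S_{N_j}$ it is false that $c_r(X_j)/|X_j|\to0$ for all $r\ge3$, and it is false that $w_r(X_j)/|X_j|\to0$ for all $r\ge3$. 7. The limiting eigenvalue density is not the McKay density: for every sequence $N_j\to\infty$ the expected empirical eigenvalue distributions over $\mathcal X_{N_j}$ do not converge weakly to $f_3(x)\,dx$, and for no sequence $X_j\in\mathcal X_{N_j}$ do the empirical eigenvalue distributions of the $X_j$ converge weakly to $f_3(x)\,dx$. -/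

import Mathlib

open Filter Topology MeasureTheory
open scoped BoundedContinuousFunction Matrix

noncomputable section

namespace OneFace

/-! ## Multigraphs: degrees, closed walks, cycles, trees, adjacency matrix -/

section Multigraph

variable {V E : Type*}

/-- The degree of a vertex: loops count twice. -/
def degree (G : Graph V E) (v : V) : ℕ :=
  (G.incidenceSet v).ncard + (G.loopSet v).ncard

/-- The vertices `v 0, …, v (r-1)` and the edges `e 0, …, e (r-1)` form a closed walk
`v 0, e 0, v 1, …, v (r-1), e (r-1), v 0`. -/
def IsClosedWalk (G : Graph V E) (r : ℕ) (v : Fin r → V) (e : Fin r → E) : Prop :=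
  ∀ i, G.IsLink (e i) (v i) (v (finRotate r i))

/-- `w_r(G)`, the number of closed walks of length `r` (with a starting point and a direction). -/
def closedWalkCount (G : Graph V E) (r : ℕ) : ℕ :=
  {p : (Fin r → V) × (Fin r → E) | IsClosedWalk G r p.1 p.2}.ncard

/-- `F` is the edge set of a cycle of length `r`: a closed walk without repeated vertices or edges.
In a multigraph a loop is a cycle of length `1` and two parallel edges form a cycle of
length `2`. -/
def IsCycle (G : Graph V E) (r : ℕ) (F : Set E) : Prop :=
  0 < r ∧ ∃ (v : Fin r → V) (e : Fin r → E),
    IsClosedWalk G r v e ∧ v.Injective ∧ e.Injective ∧ F = Set.range e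

/-- `c_r(G)`, the number of cycles of length `r`, a cycle being identified with its edge set. -/
def cycleCount (G : Graph V E) (r : ℕ) : ℕ := {F : Set E | IsCycle G r F}.ncard

/-- A tree: a nonempty connected multigraph without cycles (in particular without loops or
parallel edges). -/
def IsTree (G : Graph V E) : Prop :=
  G.vertexSet.Nonempty ∧
    (∀ u ∈ G.vertexSet, ∀ v ∈ G.vertexSet, Relation.ReflTransGen G.Adj u v) ∧
    ∀ r F, ¬ IsCycle G r F

/-- The adjacency matrix: the entry at `(i, j)` is the number of edges between `i` and `j`. -/
def adjMatrix (G : Graph V E) : Matrix V V ℝ := fun i j => ({e | G.IsLink e i j}.ncard : ℝ)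

theorem adjMatrix_isHermitian (G : Graph V E) : (adjMatrix G).IsHermitian := by
  ext i j
  simp [adjMatrix, Matrix.conjTranspose_apply, G.isLink_comm]

/-- The integral of `g` against the empirical eigenvalue distribution of `G`, that is, the average
of `g` over the eigenvalues (with multiplicity) of the adjacency matrix. -/
def spectralAverage [Fintype V] [DecidableEq V] (G : Graph V E) (g : ℝ → ℝ) : ℝ :=
  (∑ i, g ((adjMatrix_isHermitian G).eigenvalues i)) / Fintype.card V

end Multigraph

/-! ## The McKay density and limiting densities -/

/-- The McKay density `f_k`. -/
def mckayDensity (k : ℕ) (x : ℝ) : ℝ :=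
  if |x| ≤ 2 * √((k : ℝ) - 1) then
    k * √(4 * ((k : ℝ) - 1) - x ^ 2) / (2 * Real.pi * ((k : ℝ) ^ 2 - x ^ 2))
  else 0

/-- `f` is the limiting density of a sequence of distributions on the line, given by their
integration functionals `μ n` (weak convergence to `f(x) dx`). -/
def HasLimitingDensity (μ : ℕ → (ℝ → ℝ) → ℝ) (f : ℝ → ℝ) : Prop :=
  ∀ g : ℝ →ᵇ ℝ, Tendsto (fun n => μ n g) atTop (𝓝 (∫ x, g x * f x))

/-- The expected value of `f` at a uniformly chosen random element of a finite type. -/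
def expect {α : Type*} [Fintype α] (f : α → ℝ) : ℝ := (∑ a, f a) / Fintype.card α

/-! ## Pair partitions and their three-regular graphs -/

/-- A pair partition of the `2N` sides of a `2N`-gon, as the fixed-point-free involution that
exchanges the two members of each pair. -/
def Pairing (N : ℕ) : Type :=
  {π : Equiv.Perm (Fin (2 * N)) // (∀ i, π (π i) = i) ∧ ∀ i, π i ≠ i}

namespace Pairing

variable {N : ℕ}

/-- The involution of a pair partition. -/
def perm (π : Pairing N) : Equiv.Perm (Fin (2 * N)) := π.1

theorem perm_perm (π : Pairing N) (i) : π.perm (π.perm i) = i := π.2.1 i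

theorem perm_ne (π : Pairing N) (i) : π.perm i ≠ i := π.2.2 i

/-- The three-regular graph of a pair partition. Its vertices are the `2N` sides. Its edges are
the `2N` edges `Sum.inl i` of the cycle, from `i` to `i + 1` modulo `2N`, and the `N` edges
`Sum.inr s(i, π i)` joining the two sides of a pair. -/
def cubicGraph (π : Pairing N) : Graph (Fin (2 * N)) (Fin (2 * N) ⊕ Sym2 (Fin (2 * N))) where
  vertexSet := Set.univ
  IsLink e x y := match e with
    | Sum.inl i => s(i, finRotate (2 * N) i) = s(x, y)
    | Sum.inr c => c = s(x, y) ∧ π.perm x = y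
  isLink_symm := by
    rintro (i | c) - <;> constructor
    · intro x y h
      exact Eq.trans h Sym2.eq_swap
    · rintro x y ⟨h, h'⟩
      exact ⟨h.trans Sym2.eq_swap, by rw [← h', perm_perm]⟩
  eq_or_eq_of_isLink_of_isLink := by
    rintro (i | c) x y v w h h'
    · have := h.symm.trans h'
      simp only [Sym2.eq_iff] at this
      tauto
    · have := h.1.symm.trans h'.1
      simp only [Sym2.eq_iff] at this
      tauto
  left_mem_of_isLink := by simp

/-! ### The one-face map: gluing the `2N`-gon -/

/-- Side `i` of the `2N`-gon runs from corner `i` to corner `i + 1`. Gluing side `i` to side `π i`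
with reversed direction identifies corner `π i + 1` with corner `i` (and corner `i + 1` with
corner `π i`, which is the same condition for the side `π i`). The vertices of the embedded graph
are the resulting classes of corners, that is, the orbits of `i ↦ π i + 1`. -/
def cornerSetoid (π : Pairing N) : Setoid (Fin (2 * N)) :=
  Equiv.Perm.SameCycle.setoid (finRotate (2 * N) * π.perm)

/-- The vertices of the embedded graph of the one-face map. -/
def MapVertex (π : Pairing N) : Type := Quotient π.cornerSetoid

/-- The vertex of the embedded graph at a corner of the polygon. -/
def corner (π : Pairing N) (i : Fin (2 * N)) : π.MapVertex := Quotient.mk π.cornerSetoid i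

theorem corner_glue (π : Pairing N) (i) :
    π.corner (finRotate (2 * N) (π.perm i)) = π.corner i :=
  (Quotient.sound (s := π.cornerSetoid)
    (show Equiv.Perm.SameCycle (finRotate (2 * N) * π.perm) i _ from ⟨1, by simp⟩)).symm

/-- The graph embedded in the glued surface: the edge `s(i, π i)`, the common image of the sides
`i` and `π i`, joins the image of corner `i` to the image of corner `i + 1`. -/
def embeddedGraph (π : Pairing N) : Graph π.MapVertex (Sym2 (Fin (2 * N))) where
  vertexSet := Set.univ
  IsLink c u v :=
    ∃ i, c = s(i, π.perm i) ∧ u = π.corner i ∧ v = π.corner (finRotate (2 * N) i)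
  isLink_symm := by
    rintro c -
    constructor
    rintro u v ⟨i, rfl, rfl, rfl⟩
    refine ⟨π.perm i, ?_, ?_, ?_⟩
    · rw [perm_perm, Sym2.eq_swap]
    · rw [← π.corner_glue (π.perm i), perm_perm]
    · rw [corner_glue]
  eq_or_eq_of_isLink_of_isLink := by
    rintro c x y v w ⟨i, rfl, rfl, rfl⟩ ⟨j, hj, rfl, rfl⟩
    rcases Sym2.eq_iff.1 hj with ⟨h, -⟩ | ⟨h, -⟩
    · exact Or.inl (by rw [h])
    · right
      rw [h, ← π.corner_glue (π.perm j), perm_perm]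
  left_mem_of_isLink := by simp

/-- The Euler characteristic (vertices minus edges plus faces) of the surface obtained from the
`2N`-gon by the gluing; the embedded graph has `N` edges and one face. -/
def eulerChar (π : Pairing N) : ℤ := (Nat.card π.MapVertex : ℤ) - N + 1

/-- The number of vertices of degree `d` of the embedded graph. -/
def degreeCount (π : Pairing N) (d : ℕ) : ℕ := {v | degree π.embeddedGraph v = d}.ncard

/-! ### The planar drawing of the three-regular graph

The cycle is drawn as a circle, traversed counterclockwise, and the other edges inside it. -/

/-- Darts (directed edges), by their initial vertex `i` and their kind: `(i, 0)` goes from `i` to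
`i + 1` along the circle, `(i, 1)` goes from `i` to `π i` inside the circle and `(i, 2)` goes
from `i` to `i - 1` along the circle. At each vertex the kinds `0, 1, 2` follow each other in
counterclockwise order. -/
abbrev Dart (N : ℕ) : Type := Fin (2 * N) × Fin 3

/-- The same edge in the opposite direction. -/
def reverseFun (π : Pairing N) : Dart N → Dart N
  | (i, 0) => (finRotate (2 * N) i, 2)
  | (i, 1) => (π.perm i, 1)
  | (i, 2) => ((finRotate (2 * N)).symm i, 0)

theorem reverseFun_involutive (π : Pairing N) : Function.Involutive π.reverseFun := by
  rintro ⟨i, t⟩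
  fin_cases t
  · exact Prod.ext ((finRotate (2 * N)).symm_apply_apply i) rfl
  · exact Prod.ext (π.perm_perm i) rfl
  · exact Prod.ext ((finRotate (2 * N)).apply_symm_apply i) rfl

/-- Reversal of darts. -/
def reverse (π : Pairing N) : Equiv.Perm (Dart N) := π.reverseFun_involutive.toPerm

/-- The counterclockwise rotation of the darts at each vertex. -/
def rotation (N : ℕ) : Equiv.Perm (Dart N) :=
  Equiv.prodCongr (Equiv.refl (Fin (2 * N))) (finRotate 3)

/-- The next dart along the boundary of the face to the left of a dart: reverse the dart, then
take the next dart clockwise. -/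
def facePerm (π : Pairing N) : Equiv.Perm (Dart N) := (rotation N)⁻¹ * π.reverse

/-- The faces of the drawing. -/
def Face (π : Pairing N) : Type := Quotient (Equiv.Perm.SameCycle.setoid π.facePerm)

/-- The face to the left of a dart. -/
def faceOf (π : Pairing N) (d : Dart N) : π.Face :=
  Quotient.mk (Equiv.Perm.SameCycle.setoid π.facePerm) d

/-- The internal faces. The infinite face is the one outside the circle, that is, to the left of
the darts that run clockwise along the circle. -/
def InternalFace (π : Pairing N) : Type :=
  {f : π.Face // ∀ i : Fin (2 * N), π.faceOf (i, 2) ≠ f}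

/-- The edge of the three-regular graph underlying a dart. -/
def dartEdge (π : Pairing N) : Dart N → Fin (2 * N) ⊕ Sym2 (Fin (2 * N))
  | (i, 0) => Sum.inl i
  | (i, 1) => Sum.inr s(i, π.perm i)
  | (i, 2) => Sum.inl ((finRotate (2 * N)).symm i)

/-- The length of the boundary of a face. -/
def faceLength (π : Pairing N) (f : π.Face) : ℕ := {d | π.faceOf d = f}.ncard

/-- The set of the edges on the boundary of a face. -/
def faceBoundary (π : Pairing N) (f : π.Face) : Set (Fin (2 * N) ⊕ Sym2 (Fin (2 * N))) :=
  π.dartEdge '' {d | π.faceOf d = f}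

end Pairing

/-- The one-face maps with `N` edges and genus zero (the surface has Euler characteristic `2`). -/
def GenusZeroMap (N : ℕ) : Type := {π : Pairing N // π.eulerChar = 2}

instance (N : ℕ) : Fintype (GenusZeroMap N) :=
  letI : Fintype (Pairing N) := inferInstanceAs (Fintype
    {π : Equiv.Perm (Fin (2 * N)) // (∀ i, π (π i) = i) ∧ ∀ i, π i ≠ i})
  letI : DecidablePred fun π : Pairing N => π.eulerChar = 2 := Classical.decPred _
  inferInstanceAs (Fintype {π : Pairing N // π.eulerChar = 2})

namespace GenusZeroMap

variable {N : ℕ}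

/-- The three-regular graph representing a genus-zero one-face map. -/
def graph (X : GenusZeroMap N) : Graph (Fin (2 * N)) (Fin (2 * N) ⊕ Sym2 (Fin (2 * N))) :=
  X.1.cubicGraph

end GenusZeroMap

/-! ## The matrices `C + Pᵀ T P` -/

/-- `C`, the adjacency matrix of the cycle graph on `2N` vertices. -/
def cycleMatrix (N : ℕ) : Matrix (Fin (2 * N)) (Fin (2 * N)) ℝ := fun i j =>
  (if j = finRotate (2 * N) i then 1 else 0) + (if i = finRotate (2 * N) j then 1 else 0)

/-- `T`, the adjacency matrix of the standard toothpick graph: vertices `0` and `1`, vertices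
`2` and `3`, and so on, are adjacent. -/
def toothpickMatrix (N : ℕ) : Matrix (Fin (2 * N)) (Fin (2 * N)) ℝ := fun i j =>
  if i ≠ j ∧ i.val / 2 = j.val / 2 then 1 else 0

end OneFace

end

open OneFace

/-!
The corners of the polygon that are glued to one vertex form a cycle of the permutation
`ρ = c * π`, where `c` is the rotation of the sides and `π` the pairing. Most of the argument is
about such pairs of permutations of a finite set, with `IsPlane c π` for genus zero.

*Trees and faces.* The vertices outnumber the `N` edges by one, so deleting any edge disconnects
the embedded graph (`IsPlane.exists_equivalence`): it is a tree. Following the boundary of a face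
of the drawing alternates circle edges and chords; two steps are one step of `ρ`, so that every
internal face surrounds one vertex (`Pairing.sameCycle_facePerm_iff`). As the tree has no loops,
no vertex or edge is repeated along that boundary (`Pairing.isCycle_faceBoundary`).

*Degrees.* Let `T N k` be the number of genus-zero maps with `N` edges whose vertex at a given
corner has degree `k`. If the first edge at that corner leads to a leaf, the edge can be deleted;
otherwise the first subtree of the child can be moved to the root (`flipRoot`). On permutations both
operations are multiplications by transpositions, whose effect on cycles is `sameCycle_swap_mul`.
Hence `T (N + 1) (k + 1) = T N k + T (N + 1) (k + 2)` for `N ≥ 1` (`planeCount_rec`), which gives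
the ballot numbers, and the total number of maps is a Catalan number. As consecutive Catalan numbers have the
limiting ratio `1 / 4`, the recursion also yields the limit `k / 2 ^ (k + 1)` for the distribution
of the degree at a corner (`tendsto_planeCount_div`). A vertex of degree `k` has `k` corners and
all `2 N` corners are equally likely, so there are about `N / 2 ^ k` vertices of degree `k`. Since
their number is at most `2 N`, it exceeds a fixed fraction of its mean with probability bounded away
from zero, and every vertex of degree `k` contributes a `2k`-cycle.

*Eigenvalues.* The fourth moment of the McKay density is `15`, the number of closed walks of length
four at a vertex of the three-regular tree. In every genus-zero graph, a positive proportion of the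
corners is fixed by `ρ ^ 2`, because `ρ` has `N + 1` cycles on `2 N` points, and these produce
additional closed walks of length four (`le_trace_pow_four`). The fourth moments of all the graphs
are therefore at least `31 / 2`. The eigenvalues lie in `[-3, 3]`, so the bounded test function
`max (81 - x ^ 4) 0` detects the difference; it also cancels the denominator `9 - x ^ 2` of the
density, and its integral is computed from those of `√(1 - x ^ 2)` and `x ^ 2 √(1 - x ^ 2)`.
-/

namespace OneFace

/-! ### Cycles of permutations -/

section Cycles

variable {V W : Type*}

/-- The number of cycles of a permutation, fixed points included. -/
noncomputable def numCycles (σ : Equiv.Perm V) : ℕ :=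
  Nat.card (Quotient (Equiv.Perm.SameCycle.setoid σ))

/-- The cycle of a permutation through a point, as a set. -/
noncomputable def cycleSet (σ : Equiv.Perm V) (x : V) : Set V := {y | σ.SameCycle x y}

/-- The length of the cycle of a permutation through a point. -/
noncomputable def cycleSize (σ : Equiv.Perm V) (x : V) : ℕ := (cycleSet σ x).ncard

theorem mem_cycleSet {σ : Equiv.Perm V} {x y : V} : y ∈ cycleSet σ x ↔ σ.SameCycle x y := Iff.rfl

theorem self_mem_cycleSet (σ : Equiv.Perm V) (x : V) : x ∈ cycleSet σ x :=
  Equiv.Perm.SameCycle.refl σ x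

theorem sameCycle_apply (σ : Equiv.Perm V) (x : V) : σ.SameCycle x (σ x) := ⟨1, by simp⟩

/-- An equivalence relation that contains all the steps `x`, `σ x` contains the orbit relation. -/
theorem rel_of_sameCycle [Finite V] {σ : Equiv.Perm V} {r : V → V → Prop} (hr : Equivalence r)
    (h : ∀ x, r x (σ x)) {x y : V} (hxy : σ.SameCycle x y) : r x y := by
  obtain ⟨n, rfl⟩ := hxy.exists_nat_pow_eq
  induction n with
  | zero => exact hr.refl _
  | succ n ih =>
    rw [pow_succ']
    exact hr.trans (ih ⟨n, by simp⟩) (h _)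

theorem eq_of_sameCycle [Finite V] {σ : Equiv.Perm V} {α : Type*} {f : V → α}
    (h : ∀ x, f (σ x) = f x) {x y : V} (hxy : σ.SameCycle x y) : f x = f y :=
  rel_of_sameCycle (r := fun a b => f a = f b)
    ⟨fun _ => rfl, fun h => h.symm, fun h h' => h.trans h'⟩
    (fun x => (h x).symm) hxy

theorem cycleSize_pos [Finite V] (σ : Equiv.Perm V) (x : V) : 0 < cycleSize σ x :=
  (Set.ncard_pos (Set.toFinite _)).2 ⟨x, self_mem_cycleSet σ x⟩

theorem cycleSize_le_card [Finite V] (σ : Equiv.Perm V) (x : V) : cycleSize σ x ≤ Nat.card V :=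
  Set.ncard_le_card _

theorem cycleSize_eq_of_sameCycle {σ : Equiv.Perm V} {x y : V} (h : σ.SameCycle x y) :
    cycleSize σ x = cycleSize σ y := by
  unfold cycleSize
  congr 1
  ext z
  exact ⟨fun hz => h.symm.trans hz, fun hz => h.trans hz⟩

theorem sameCycle_conj_equiv (e : V ≃ W) (σ : Equiv.Perm V) (τ : Equiv.Perm W)
    (h : ∀ x, e (σ x) = τ (e x)) (x y : V) : τ.SameCycle (e x) (e y) ↔ σ.SameCycle x y := by
  have hτ : τ = e.permCongr σ := by
    ext w
    simp [Equiv.permCongr_apply, h]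
  have key : ∀ n : ℤ, (e.permCongr σ ^ n) (e x) = e ((σ ^ n) x) := by
    intro n
    have : e.permCongr σ ^ n = e.permCongr (σ ^ n) := (map_zpow e.permCongrHom σ n).symm
    rw [this]
    simp [Equiv.permCongr_apply]
  simp only [Equiv.Perm.SameCycle, hτ, key, e.injective.eq_iff]

theorem numCycles_conj_equiv (e : V ≃ W) {σ : Equiv.Perm V} {τ : Equiv.Perm W}
    (h : ∀ x, e (σ x) = τ (e x)) : numCycles σ = numCycles τ :=
  Nat.card_congr (Quotient.congr e fun x y => (sameCycle_conj_equiv e σ τ h x y).symm)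

theorem cycleSize_conj_equiv (e : V ≃ W) {σ : Equiv.Perm V} {τ : Equiv.Perm W}
    (h : ∀ x, e (σ x) = τ (e x)) (x : V) : cycleSize τ (e x) = cycleSize σ x := by
  unfold cycleSize
  rw [← Set.ncard_image_of_injective _ e.injective]
  congr 1
  ext w
  obtain ⟨y, rfl⟩ := e.surjective w
  simp [mem_cycleSet, sameCycle_conj_equiv e σ τ h]

/-- The cycle through `x`, enumerated by the powers of the permutation. -/
theorem exists_enum_cycle [Finite V] (σ : Equiv.Perm V) (x : V) :
    ∃ f : Fin (cycleSize σ x) → V, f.Injective ∧ Set.range f = cycleSet σ x ∧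
      (∀ i, f (finRotate _ i) = σ (f i)) ∧ ∀ i, i.val = 0 → f i = x := by
  have hp : 0 < Function.minimalPeriod σ x :=
    Function.minimalPeriod_pos_of_mem_periodicPts
      ((Function.mem_periodicPts).2 (by
        obtain ⟨n, hn, -, h⟩ := (Equiv.Perm.SameCycle.refl σ x).exists_pow_eq''
        exact ⟨n, hn, by rw [Equiv.Perm.coe_pow] at h; exact h⟩))
  obtain ⟨m, hm⟩ : ∃ m, Function.minimalPeriod σ x = m + 1 := ⟨_, (Nat.succ_pred_eq_of_pos hp).symm⟩
  let f : Fin (m + 1) → V := fun i => σ^[i.val] x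
  have hinj : f.Injective := by
    intro i j hij
    exact Fin.ext (Function.iterate_injOn_Iio_minimalPeriod (by simp [hm]; omega)
      (by simp [hm]; omega) hij)
  have hran : Set.range f = cycleSet σ x := by
    ext y
    constructor
    · rintro ⟨i, rfl⟩
      exact ⟨i.val, by simp [f, Equiv.Perm.coe_pow]⟩
    · intro hy
      obtain ⟨n, rfl⟩ := hy.exists_nat_pow_eq
      refine ⟨⟨n % (m + 1), Nat.mod_lt _ (by omega)⟩, ?_⟩
      simp only [f, Equiv.Perm.coe_pow, ← hm]
      exact Function.iterate_mod_minimalPeriod_eq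
  have hrot : ∀ i, f (finRotate _ i) = σ (f i) := by
    intro i
    have h1 : ((finRotate (m + 1) i : Fin (m + 1)) : ℕ) = (i.val + 1) % (m + 1) := by
      rw [coe_finRotate]
      split_ifs with h
      · simp [h]
      · rw [Nat.mod_eq_of_lt]
        have := Fin.val_lt_last h
        omega
    simp only [f, h1, ← hm, Function.iterate_mod_minimalPeriod_eq]
    exact Function.iterate_succ_apply' σ i.val x
  have hsize : cycleSize σ x = m + 1 := by
    rw [cycleSize, ← hran, Set.ncard_range_of_injective hinj, Nat.card_fin]
  rw [hsize]
  exact ⟨f, hinj, hran, hrot, fun i hi => by simp [f, hi]⟩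

theorem sameCycle_of_numCycles_eq_one {c : Equiv.Perm V} (hc : numCycles c = 1) (x y : V) :
    c.SameCycle x y := by
  obtain ⟨h, -⟩ := Nat.card_eq_one_iff_unique.1 hc
  exact Quotient.exact (s := Equiv.Perm.SameCycle.setoid c) (Subsingleton.elim _ _)

theorem cycleSet_of_numCycles_eq_one {c : Equiv.Perm V} (hc : numCycles c = 1) (x : V) :
    cycleSet c x = Set.univ :=
  Set.eq_univ_of_forall fun y => sameCycle_of_numCycles_eq_one hc x y

theorem cycleSize_of_numCycles_eq_one {c : Equiv.Perm V} (hc : numCycles c = 1) (x : V) :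
    cycleSize c x = Nat.card V := by
  rw [cycleSize, cycleSet_of_numCycles_eq_one hc, Set.ncard_univ]

theorem apply_ne_of_numCycles_eq_one [Finite V] {c : Equiv.Perm V} (hc : numCycles c = 1)
    (h : 1 < Nat.card V) (x : V) : c x ≠ x := by
  intro hx
  have := (Finite.one_lt_card_iff_nontrivial.1 h)
  obtain ⟨y, hy⟩ := exists_ne x
  exact hy ((sameCycle_of_numCycles_eq_one hc x y).eq_of_left hx).symm

/-- Two permutations with a single cycle on sets of the same size are conjugate, by a bijection
that respects base points. -/
theorem exists_conj_of_numCycles_eq_one [Finite V] [Finite W] {c : Equiv.Perm V}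
    {d : Equiv.Perm W} (hc : numCycles c = 1) (hd : numCycles d = 1)
    (h : Nat.card V = Nat.card W) (x : V) (y : W) :
    ∃ e : V ≃ W, (∀ v, e (c v) = d (e v)) ∧ e x = y := by
  obtain ⟨f, hf, hfr, hfc, hf0⟩ := exists_enum_cycle c x
  obtain ⟨g, hg, hgr, hgd, hg0⟩ := exists_enum_cycle d y
  have hpos : 0 < cycleSize c x := cycleSize_pos c x
  have hs : cycleSize c x = cycleSize d y := by
    rw [cycleSize_of_numCycles_eq_one hc, cycleSize_of_numCycles_eq_one hd, h]
  rw [cycleSet_of_numCycles_eq_one hc, Set.range_eq_univ] at hfr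
  rw [cycleSet_of_numCycles_eq_one hd, Set.range_eq_univ] at hgr
  revert g
  rw [← hs]
  intro g hg hgr hgd hg0
  let F := Equiv.ofBijective f ⟨hf, hfr⟩
  let G := Equiv.ofBijective g ⟨hg, hgr⟩
  refine ⟨F.symm.trans G, fun v => ?_, ?_⟩
  · obtain ⟨i, rfl⟩ := F.surjective v
    have : c (F i) = F (finRotate _ i) := (hfc i).symm
    rw [this]
    simp only [Equiv.trans_apply, Equiv.symm_apply_apply]
    exact hgd i
  · have : F.symm x = ⟨0, hpos⟩ := F.symm_apply_eq.2 (hf0 _ rfl).symm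
    rw [Equiv.trans_apply, this]
    exact hg0 _ rfl

theorem numCycles_finRotate (n : ℕ) : numCycles (finRotate (n + 1)) = 1 := by
  refine Nat.card_eq_one_iff_unique.2 ⟨⟨?_⟩, ⟨Quotient.mk _ 0⟩⟩
  have key : ∀ i : Fin (n + 1), (finRotate (n + 1)).SameCycle 0 i := by
    intro i
    induction i using Fin.induction with
    | zero => exact Equiv.Perm.SameCycle.refl _ _
    | succ i ih =>
      refine ih.trans ⟨1, ?_⟩
      simp
  intro a b
  induction a using Quotient.inductionOn
  induction b using Quotient.inductionOn
  exact Quotient.sound (s := Equiv.Perm.SameCycle.setoid _) ((key _).symm.trans (key _))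

/-- Counting the points cycle by cycle: a cycle of length at least `3` has three points, and a
shorter one has at least one point, which is fixed by `σ ^ 2` and has weight `3`. -/
theorem three_mul_numCycles_le [Fintype V] [DecidableEq V] (σ : Equiv.Perm V) :
    3 * numCycles σ ≤ Fintype.card V + 2 * (Finset.univ.filter fun x => σ (σ x) = x).card := by
  classical
  let q : V → Quotient (Equiv.Perm.SameCycle.setoid σ) := Quotient.mk _
  have : Fintype (Quotient (Equiv.Perm.SameCycle.setoid σ)) := Fintype.ofFinite _
  have h1 : Fintype.card V + 2 * (Finset.univ.filter fun x => σ (σ x) = x).card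
      = ∑ x : V, (1 + 2 * if σ (σ x) = x then 1 else 0) := by
    rw [Finset.sum_add_distrib, ← Finset.mul_sum, Finset.card_filter]
    simp
  rw [h1, numCycles, Nat.card_eq_fintype_card, ← Finset.sum_fiberwise Finset.univ q, mul_comm,
    ← smul_eq_mul]
  refine Finset.card_nsmul_le_sum _ _ _ fun a _ => ?_
  obtain ⟨x, rfl⟩ := Quotient.exists_rep a
  have hmem : ∀ y, σ.SameCycle x y → y ∈ Finset.univ.filter fun z => q z = q x := by
    intro y hy
    simp only [Finset.mem_filter, Finset.mem_univ, true_and]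
    exact Quotient.sound (s := Equiv.Perm.SameCycle.setoid σ) hy.symm
  by_cases hx : σ (σ x) = x
  · calc 3 = ∑ y ∈ {x}, (1 + 2 * if σ (σ y) = y then 1 else 0) := by simp [hx]
      _ ≤ _ := Finset.sum_le_sum_of_subset (
        Finset.singleton_subset_iff.2 (hmem x (Equiv.Perm.SameCycle.refl _ _)))
  · have h01 : σ x ≠ x := fun h => hx (by rw [h, h])
    have h12 : σ (σ x) ≠ σ x := fun h => h01 (σ.injective h)
    calc 3 = ∑ y ∈ {x, σ x, σ (σ x)}, 1 := by
          rw [Finset.sum_insert (by simp [h01.symm, Ne.symm hx]), Finset.sum_pair h12.symm]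
          norm_num
      _ ≤ ∑ y ∈ {x, σ x, σ (σ x)}, (1 + 2 * if σ (σ y) = y then 1 else 0) :=
          Finset.sum_le_sum fun _ _ => by omega
      _ ≤ _ := Finset.sum_le_sum_of_subset (by
        intro y hy
        simp only [Finset.mem_insert, Finset.mem_singleton] at hy
        rcases hy with rfl | rfl | rfl
        · exact hmem _ ⟨0, by simp⟩
        · exact hmem _ ⟨1, by simp⟩
        · exact hmem _ ⟨2, by simp [pow_two, zpow_ofNat]⟩)

section Insert

variable [DecidableEq V]

/-- If `τ` fixes `y`, the permutation `swap y a * τ` arises by inserting `y` into the cycle of `a`,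
just before `a`. Its cycles are those of `τ` after moving `y` to `a`. -/
theorem sameCycle_swap_mul [Finite V] {τ : Equiv.Perm V} {y a : V} (hy : τ y = y) (hay : a ≠ y)
    (u v : V) :
    (Equiv.swap y a * τ).SameCycle u v ↔
      τ.SameCycle (if u = y then a else u) (if v = y then a else v) := by
  set σ := Equiv.swap y a * τ with hσ
  set f : V → V := fun u => if u = y then a else u with hf
  have σy : σ y = a := by simp [hσ, hy]
  constructor
  · intro h
    refine rel_of_sameCycle (r := fun u v => τ.SameCycle (f u) (f v))
      ⟨fun _ => .refl _ _, fun h => h.symm, fun h h' => h.trans h'⟩ (fun x => ?_) h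
    by_cases hx : x = y
    · subst hx
      simp [hf, σy]
      exact .refl _ _
    · have hτx : τ x ≠ y := fun h => hx (τ.injective (h.trans hy.symm))
      by_cases hxa : τ x = a
      · have : σ x = y := by simp [hσ, hxa]
        simp only [hf, this, hx, if_false, if_true]
        exact hxa ▸ sameCycle_apply τ x
      · have : σ x = τ x := by simp [hσ, Equiv.swap_apply_of_ne_of_ne hτx hxa]
        simp only [hf, this, hx, hτx, if_false]
        exact sameCycle_apply τ x
  · intro h
    have h1 : ∀ x, σ.SameCycle x (f x) := by
      intro x
      by_cases hx : x = y
      · subst hx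
        have := sameCycle_apply σ x
        rw [σy] at this
        simpa [hf] using this
      · simp only [hf, hx, if_false]
        exact .refl _ _
    have h2 : ∀ x, σ.SameCycle x (τ x) := by
      intro x
      by_cases hx : x = y
      · subst hx
        rw [hy]
      · have hτx : τ x ≠ y := fun h => hx (τ.injective (h.trans hy.symm))
        by_cases hxa : τ x = a
        · have : σ x = y := by simp [hσ, hxa]
          rw [hxa, ← σy, ← this]
          exact (sameCycle_apply σ x).trans (sameCycle_apply σ _)
        · have : σ x = τ x := by simp [hσ, Equiv.swap_apply_of_ne_of_ne hτx hxa]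
          exact this ▸ sameCycle_apply σ x
    have h3 := rel_of_sameCycle (r := σ.SameCycle)
      ⟨fun _ => .refl _ _, fun h => h.symm, fun h h' => h.trans h'⟩ h2 h
    exact (h1 u).trans (h3.trans (h1 v).symm)

theorem numCycles_swap_mul [Finite V] {τ : Equiv.Perm V} {y a : V} (hy : τ y = y) (hay : a ≠ y) :
    numCycles (Equiv.swap y a * τ) + 1 = numCycles τ := by
  classical
  let f : V → V := fun u => if u = y then a else u
  have hyq : ∀ v, τ.SameCycle y v → y = v := fun v h => h.eq_of_left hy
  have hf : ∀ u, f u ≠ y := fun u => by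
    simp only [f]
    split_ifs with h <;> assumption
  let Q := Quotient (Equiv.Perm.SameCycle.setoid τ)
  let y' : Q := Quotient.mk _ y
  let F : Quotient (Equiv.Perm.SameCycle.setoid (Equiv.swap y a * τ)) → {q : Q // q ≠ y'} :=
    Quotient.lift (fun u => (⟨Quotient.mk _ (f u), fun h =>
        hf u (hyq _ (Quotient.exact (s := Equiv.Perm.SameCycle.setoid τ) h).symm).symm⟩ :
          {q : Q // q ≠ y'}))
      (fun u v h => Subtype.ext (Quotient.sound (s := Equiv.Perm.SameCycle.setoid τ)
        ((sameCycle_swap_mul hy hay u v).1 h)))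
  have hF : Function.Bijective F := by
    constructor
    · intro p q
      refine Quotient.inductionOn₂ p q fun u v h => ?_
      refine Quotient.sound (s := Equiv.Perm.SameCycle.setoid _) ((sameCycle_swap_mul hy hay u v).2 ?_)
      exact Quotient.exact (s := Equiv.Perm.SameCycle.setoid τ) (congrArg Subtype.val h)
    · rintro ⟨q, hq⟩
      induction q using Quotient.inductionOn with
      | h u =>
        have hu : u ≠ y := by
          rintro rfl
          exact hq rfl
        exact ⟨Quotient.mk _ u, Subtype.ext (by simp [F, f, hu])⟩
  have : Fintype Q := Fintype.ofFinite _
  have hcard := Fintype.card_subtype_compl (fun q : Q => q = y')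
  have hpos : 0 < Fintype.card Q := Fintype.card_pos_iff.2 ⟨y'⟩
  rw [Fintype.card_subtype_eq] at hcard
  rw [numCycles, Nat.card_congr (Equiv.ofBijective F hF), Nat.card_eq_fintype_card, numCycles,
    Nat.card_eq_fintype_card]
  change _ = Fintype.card Q
  simp only [ne_eq]
  omega

theorem cycleSize_swap_mul [Finite V] {τ : Equiv.Perm V} {y a : V} (hy : τ y = y) (hay : a ≠ y) :
    cycleSize (Equiv.swap y a * τ) a = cycleSize τ a + 1 := by
  have h : cycleSet (Equiv.swap y a * τ) a = insert y (cycleSet τ a) := by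
    ext v
    simp only [mem_cycleSet, sameCycle_swap_mul hy hay, hay, if_false, Set.mem_insert_iff]
    by_cases hv : v = y
    · simp only [hv, if_true, true_or, iff_true]
      exact .refl _ _
    · simp [hv]
  have hn : y ∉ cycleSet τ a := fun h => hay (h.symm.eq_of_left hy).symm
  rw [cycleSize, h, Set.ncard_insert_of_notMem hn (Set.toFinite _), cycleSize]

theorem cycleSize_swap_mul_of_not_sameCycle [Finite V] {τ : Equiv.Perm V} {y a x : V}
    (hy : τ y = y) (hay : a ≠ y) (hxy : x ≠ y) (h : ¬ τ.SameCycle x a) :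
    cycleSize (Equiv.swap y a * τ) x = cycleSize τ x := by
  unfold cycleSize
  congr 1
  ext v
  simp only [mem_cycleSet, sameCycle_swap_mul hy hay, hxy, if_false]
  by_cases hv : v = y
  · subst hv
    simp only [if_true, h, false_iff]
    exact fun h' => hxy (h'.symm.eq_of_left hy).symm
  · simp [hv]

end Insert

end Cycles

/-! ### Plane one-face maps on an arbitrary finite set of sides -/

section Plane

variable {V W : Type*}

/-- A one-face map of genus zero on an arbitrary set `V` of sides: the single cycle `c` is the
cyclic order of the sides around the polygon, `π` is the fixed-point-free involution that glues
them, and Euler's formula holds. The corner at the start of a side is denoted by the side itself,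
so that the vertices of the map are the cycles of `c * π`. -/
structure IsPlane (c π : Equiv.Perm V) : Prop where
  cycle : numCycles c = 1
  invol : ∀ i, π (π i) = i
  ne : ∀ i, π i ≠ i
  euler : 2 * numCycles (c * π) = Nat.card V + 2

/-- Removing an edge of a plane one-face map disconnects its ends: some equivalence relation on
the corners is compatible with the gluing and with all sides except `i₀` and `π i₀`, but separates
the ends of `i₀`. Otherwise `N - 1` edges would connect `N + 1` vertices. -/
theorem IsPlane.exists_equivalence [Finite V] {c π : Equiv.Perm V} (h : IsPlane c π) (i₀ : V) :
    ∃ r : V → V → Prop, Equivalence r ∧ (∀ i, r i (c (π i))) ∧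
      (∀ i, i ≠ i₀ → i ≠ π i₀ → r i (c i)) ∧ ¬ r i₀ (c i₀) := by
  classical
  have : Fintype V := Fintype.ofFinite V
  let q : V → Quotient (Equiv.Perm.SameCycle.setoid (c * π)) := Quotient.mk _
  have hq : ∀ i, q i = q (c (π i)) := fun i =>
    Quotient.sound (s := Equiv.Perm.SameCycle.setoid (c * π)) (sameCycle_apply (c * π) i)
  have : Fintype (Quotient (Equiv.Perm.SameCycle.setoid (c * π))) := Fintype.ofFinite _
  let D : Finset V := Finset.univ \ {i₀, π i₀}
  have hD : ∀ i, i ∈ D ↔ i ≠ i₀ ∧ i ≠ π i₀ := fun i => by simp [D]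
  let H : SimpleGraph (Quotient (Equiv.Perm.SameCycle.setoid (c * π))) :=
    SimpleGraph.fromRel fun u v => ∃ i ∈ D, u = q i ∧ v = q (c i)
  let r : V → V → Prop := fun i j => H.Reachable (q i) (q j)
  have hr : Equivalence r := ⟨fun _ => .refl _, fun h => h.symm, fun h h' => h.trans h'⟩
  have h1 : ∀ i, r i (c (π i)) := fun i => by
    simp only [r, ← hq]
    exact .refl _
  have h2 : ∀ i, i ≠ i₀ → i ≠ π i₀ → r i (c i) := by
    intro i hi hi'
    by_cases hqi : q i = q (c i)
    · simp only [r, ← hqi]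
      exact .refl _
    · exact SimpleGraph.Adj.reachable
        ((SimpleGraph.fromRel_adj _ _ _).2 ⟨hqi, Or.inl ⟨i, (hD i).2 ⟨hi, hi'⟩, rfl, rfl⟩⟩)
  refine ⟨r, hr, h1, h2, fun h3 => ?_⟩
  have h4 : r (π i₀) (c (π i₀)) := by
    have h5 := h1 (π i₀)
    rw [h.invol] at h5
    exact hr.trans h5 (hr.trans (hr.symm h3) (h1 i₀))
  have h5 : ∀ i, r i (c i) := by
    intro i
    by_cases hi : i = i₀
    · exact hi ▸ h3
    · by_cases hi' : i = π i₀
      · exact hi' ▸ h4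
      · exact h2 i hi hi'
  have hconn : H.Connected := by
    have : Nonempty (Quotient (Equiv.Perm.SameCycle.setoid (c * π))) := ⟨q i₀⟩
    refine SimpleGraph.Connected.mk fun u v => ?_
    obtain ⟨i, rfl⟩ := Quotient.exists_rep u
    obtain ⟨j, rfl⟩ := Quotient.exists_rep v
    exact rel_of_sameCycle hr h5 (sameCycle_of_numCycles_eq_one h.cycle i j)
  have hcard := hconn.card_vert_le_card_edgeSet_add_one
  let g : V → Sym2 (Quotient (Equiv.Perm.SameCycle.setoid (c * π))) := fun i => s(q i, q (c i))
  have hg : ∀ i, g (π i) = g i := by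
    intro i
    have := hq (π i)
    rw [h.invol] at this
    simp only [g, this, ← hq i]
    exact Sym2.eq_swap
  have hsub : H.edgeSet ⊆ ((D.image g : Finset _) : Set _) := by
    intro e
    induction e using Sym2.ind with
    | _ u v =>
      intro he
      obtain ⟨-, ⟨i, hi, rfl, rfl⟩ | ⟨i, hi, rfl, rfl⟩⟩ := (SimpleGraph.fromRel_adj _ _ _).1
        ((SimpleGraph.mem_edgeSet _).1 he)
      · exact Finset.mem_coe.2 (Finset.mem_image.2 ⟨i, hi, rfl⟩)
      · exact Finset.mem_coe.2 (Finset.mem_image.2 ⟨i, hi, Sym2.eq_swap⟩)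
  have hedges : Nat.card H.edgeSet ≤ (D.image g).card := by
    rw [Nat.card_coe_set_eq, ← Set.ncard_coe_finset]
    exact Set.ncard_le_ncard hsub (Set.toFinite _)
  have himage : 2 * (D.image g).card ≤ D.card := by
    refine Finset.mul_card_image_le_card D 2 fun e he => ?_
    obtain ⟨i, hi, rfl⟩ := Finset.mem_image.1 he
    rw [← Finset.card_pair (h.ne i)]
    refine Finset.card_le_card fun j hj => ?_
    simp only [Finset.mem_insert, Finset.mem_singleton] at hj
    rw [Finset.mem_filter]
    rcases hj with rfl | rfl
    · refine ⟨(hD _).2 ⟨fun h' => ((hD i).1 hi).2 ?_, fun h' => ((hD i).1 hi).1 ?_⟩, hg i⟩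
      · rw [← h', h.invol]
      · exact π.injective h'
    · exact ⟨hi, rfl⟩
  have hDcard : D.card + 2 = Fintype.card V := by
    have := Finset.card_sdiff_add_card_eq_card (Finset.subset_univ {i₀, π i₀})
    rwa [Finset.card_pair (h.ne i₀).symm, Finset.card_univ] at this
  have he := h.euler
  rw [Nat.card_eq_fintype_card (α := V)] at he
  simp only [numCycles] at he
  omega

/-- The edges of a plane one-face map are not loops. -/
theorem IsPlane.not_sameCycle [Finite V] {c π : Equiv.Perm V} (h : IsPlane c π) (x : V) :
    ¬ (c * π).SameCycle x (c x) := by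
  obtain ⟨r, hr, h1, -, h3⟩ := h.exists_equivalence x
  exact fun h' => h3 (rel_of_sameCycle hr h1 h')

theorem isPlane_conj_equiv (e : V ≃ W) {c : Equiv.Perm V} {d : Equiv.Perm W}
    (he : ∀ v, e (c v) = d (e v)) (π : Equiv.Perm V) :
    IsPlane d (e.permCongr π) ↔ IsPlane c π := by
  have h1 : numCycles c = numCycles d := numCycles_conj_equiv e he
  have h2 : numCycles (c * π) = numCycles (d * e.permCongr π) :=
    numCycles_conj_equiv e fun x => by simp [he, Equiv.permCongr_apply]
  have h3 : Nat.card V = Nat.card W := Nat.card_congr e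
  constructor
  · rintro ⟨a1, a2, a3, a4⟩
    refine ⟨h1.trans a1, fun i => ?_, fun i hi => a3 (e i) ?_, by rw [h2, h3, a4]⟩
    · simpa [Equiv.permCongr_apply] using a2 (e i)
    · simp [Equiv.permCongr_apply, hi]
  · rintro ⟨a1, a2, a3, a4⟩
    refine ⟨h1.symm.trans a1, fun i => ?_, fun i hi => a3 (e.symm i) ?_, by rw [← h2, ← h3, a4]⟩
    · simp [Equiv.permCongr_apply, a2]
    · rw [Equiv.eq_symm_apply]
      simpa [Equiv.permCongr_apply] using hi

/-- The number of plane one-face maps on the polygon `c` whose vertex at the corner `x` has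
degree `k`. -/
noncomputable def rootCount (c : Equiv.Perm V) (x : V) (k : ℕ) : ℕ :=
  Nat.card {π : Equiv.Perm V // IsPlane c π ∧ cycleSize (c * π) x = k}

/-- The number of plane one-face maps on the polygon `c` whose vertex at the corner `x` has
degree `k` and for which the edge starting at `x` leads to a leaf. -/
noncomputable def leafRootCount (c : Equiv.Perm V) (x : V) (k : ℕ) : ℕ :=
  Nat.card {π : Equiv.Perm V // IsPlane c π ∧ π x = c x ∧ cycleSize (c * π) x = k}

theorem cycleSize_permCongr (e : V ≃ W) {c : Equiv.Perm V} {d : Equiv.Perm W}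
    (he : ∀ v, e (c v) = d (e v)) (π : Equiv.Perm V) (x : V) :
    cycleSize (d * e.permCongr π) (e x) = cycleSize (c * π) x :=
  cycleSize_conj_equiv e (fun x => by simp [he, Equiv.permCongr_apply]) x

theorem rootCount_conj_equiv (e : V ≃ W) {c : Equiv.Perm V} {d : Equiv.Perm W}
    (he : ∀ v, e (c v) = d (e v)) (x : V) (k : ℕ) : rootCount c x k = rootCount d (e x) k :=
  Nat.card_congr (e.permCongr.subtypeEquiv fun π => by
    rw [isPlane_conj_equiv e he, cycleSize_permCongr e he])

theorem leafRootCount_conj_equiv (e : V ≃ W) {c : Equiv.Perm V} {d : Equiv.Perm W}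
    (he : ∀ v, e (c v) = d (e v)) (x : V) (k : ℕ) :
    leafRootCount c x k = leafRootCount d (e x) k :=
  Nat.card_congr (e.permCongr.subtypeEquiv fun π => by
    rw [isPlane_conj_equiv e he, cycleSize_permCongr e he, ← he]
    simp [Equiv.permCongr_apply])

end Plane

/-! ### Moving a subtree to the root -/

section Flip

variable {V : Type*} [DecidableEq V]

theorem swap_mul_swap_rotate {x y u : V} (hxy : x ≠ y) (hux : u ≠ x) (huy : u ≠ y) :
    Equiv.swap x u * Equiv.swap x y = Equiv.swap y x * Equiv.swap y u := by
  ext v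
  simp only [Equiv.Perm.mul_apply, Equiv.swap_apply_def]
  split_ifs <;> simp_all

theorem numCycles_swap_mul_swap_mul [Finite V] {c : Equiv.Perm V} {x u : V} (hx : c x ≠ x)
    (hu : u ≠ x) : numCycles (Equiv.swap x u * (Equiv.swap x (c x) * c)) = numCycles c := by
  have h0 : (Equiv.swap x (c x) * c) x = x := by simp
  have h1 := numCycles_swap_mul h0 hu
  have h2 := numCycles_swap_mul h0 hx
  rw [← mul_assoc, Equiv.swap_mul_self, one_mul] at h2
  omega

/-- Moving a point `y` from its cycle to the place just before `x` on another cycle. -/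
theorem cycleSize_swap_mul_swap_mul [Finite V] {σ : Equiv.Perm V} {x y : V} (hy : σ y ≠ y)
    (hxy : ¬ σ.SameCycle x y) :
    cycleSize (Equiv.swap y x * (Equiv.swap y (σ y) * σ)) x = cycleSize σ x + 1 := by
  have hxy' : x ≠ y := fun h => hxy (h ▸ .refl _ _)
  have h0 : (Equiv.swap y (σ y) * σ) y = y := by simp
  have hσ : Equiv.swap y (σ y) * (Equiv.swap y (σ y) * σ) = σ := by
    rw [← mul_assoc, Equiv.swap_mul_self, one_mul]
  rw [cycleSize_swap_mul h0 hxy']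
  congr 1
  conv_rhs => rw [← hσ]
  refine (cycleSize_swap_mul_of_not_sameCycle h0 hy hxy' fun h => hxy ?_).symm
  have h1 := (sameCycle_swap_mul h0 hy x (σ y)).2 (by simpa [hxy', hy] using h)
  rw [hσ] at h1
  exact h1.trans (sameCycle_apply σ y).symm

/-- Plane one-face maps with a root corner `p.1.2` at which the vertex has degree `k`. -/
def IsRooted (k : ℕ) (p : (Equiv.Perm V × V) × Equiv.Perm V) : Prop :=
  IsPlane p.1.1 p.2 ∧ cycleSize (p.1.1 * p.2) p.1.2 = k

/-- In a rooted plane one-face map the root edge `x` leads to the corner `y = c x`. If the other end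
is not a leaf, the side `x` is moved behind the side `π y` in the cyclic order, and `y` becomes the
root: the first subtree of the child is then attached to the root. -/
def flipRoot (p : (Equiv.Perm V × V) × Equiv.Perm V) : (Equiv.Perm V × V) × Equiv.Perm V :=
  ((Equiv.swap p.1.2 (p.1.1 (p.2 (p.1.1 p.1.2))) * (Equiv.swap p.1.2 (p.1.1 p.1.2) * p.1.1),
    p.1.1 p.1.2), p.2)

/-- The inverse of `flipRoot`: the first subtree of the root is attached to the second child. -/
def unflipRoot (p : (Equiv.Perm V × V) × Equiv.Perm V) : (Equiv.Perm V × V) × Equiv.Perm V :=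
  ((Equiv.swap (p.1.1 (p.2 p.1.2)) p.1.2 *
      (Equiv.swap (p.1.1 (p.2 p.1.2)) (p.1.1 (p.1.1 (p.2 p.1.2))) * p.1.1),
    p.1.1 (p.2 p.1.2)), p.2)

theorem flipRoot_spec [Finite V] {k : ℕ} {c π : Equiv.Perm V} {x : V}
    (h : IsRooted k ((c, x), π)) (hx : π x ≠ c x) :
    IsRooted (k + 1) (flipRoot ((c, x), π)) ∧ unflipRoot (flipRoot ((c, x), π)) = ((c, x), π) := by
  obtain ⟨h, hk⟩ := h
  simp only at h hk
  obtain ⟨y, hy⟩ : ∃ y, c x = y := ⟨_, rfl⟩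
  obtain ⟨u, hu⟩ : ∃ u, c (π y) = u := ⟨_, rfl⟩
  have hloop := h.not_sameCycle x
  rw [hy] at hloop
  have hxy : x ≠ y := fun h' => hloop (by rw [← h'])
  have huy : u ≠ y := by
    rintro h'
    rw [← hu, ← hy, c.injective.eq_iff, hy] at h'
    exact hx (by rw [hy, ← h', h.invol])
  have hux : u ≠ x := by
    intro h'
    have := sameCycle_apply (c * π) y
    rw [Equiv.Perm.mul_apply, hu, h'] at this
    exact hloop this.symm
  have hρ : Equiv.swap x u * (Equiv.swap x y * c) * π =
      Equiv.swap y x * (Equiv.swap y ((c * π) y) * (c * π)) := by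
    rw [Equiv.Perm.mul_apply, hu, ← mul_assoc, ← mul_assoc,
      swap_mul_swap_rotate hxy hux huy, mul_assoc, mul_assoc]
  have hρy : (c * π) y = u := hu
  have hflip : flipRoot ((c, x), π) = ((Equiv.swap x u * (Equiv.swap x y * c), y), π) := by
    simp only [flipRoot, hy, hu]
  rw [hflip]
  refine ⟨⟨⟨?_, h.invol, h.ne, ?_⟩, ?_⟩, ?_⟩
  · have := numCycles_swap_mul_swap_mul (c := c) (x := x) (by rw [hy]; exact hxy.symm) hux
    rw [hy] at this
    exact this.trans h.cycle
  · simp only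
    rw [hρ, numCycles_swap_mul_swap_mul (by rw [hρy]; exact huy) hxy, h.euler]
  · simp only
    rw [hρ]
    have h1 := cycleSize_swap_mul_swap_mul (σ := c * π) (by rw [hρy]; exact huy) hloop
    rw [← hk, ← h1]
    refine cycleSize_eq_of_sameCycle ?_
    have := sameCycle_apply (Equiv.swap y x * (Equiv.swap y ((c * π) y) * (c * π))) y
    simpa using this
  · have e1 : (Equiv.swap x u * (Equiv.swap x y * c)) (π y) = x := by
      simp [hu, Equiv.swap_apply_of_ne_of_ne hux huy]
    have e2 : (Equiv.swap x u * (Equiv.swap x y * c)) x = u := by simp [hy]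
    simp only [unflipRoot, e1, e2]
    rw [← mul_assoc (Equiv.swap x u), Equiv.swap_mul_self, one_mul, ← mul_assoc,
      Equiv.swap_mul_self, one_mul]

theorem unflipRoot_spec [Finite V] {k : ℕ} {c π : Equiv.Perm V} {y : V}
    (h : IsRooted (k + 2) ((c, y), π)) :
    IsRooted (k + 1) (unflipRoot ((c, y), π)) ∧
      (unflipRoot ((c, y), π)).2 (unflipRoot ((c, y), π)).1.2 ≠
        (unflipRoot ((c, y), π)).1.1 (unflipRoot ((c, y), π)).1.2 ∧
      flipRoot (unflipRoot ((c, y), π)) = ((c, y), π) := by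
  obtain ⟨h, hk⟩ := h
  simp only at h hk
  obtain ⟨x, hx⟩ : ∃ x, c (π y) = x := ⟨_, rfl⟩
  obtain ⟨u, hu⟩ : ∃ u, c x = u := ⟨_, rfl⟩
  have hloop := h.not_sameCycle x
  rw [hu] at hloop
  have hρy : (c * π) y = x := hx
  have hyx : (c * π).SameCycle y x := hx ▸ sameCycle_apply (c * π) y
  have hux : u ≠ x := fun h' => hloop (by rw [h'])
  have huy : u ≠ y := fun h' => hloop (by rw [h']; exact hyx.symm)
  have hxy : x ≠ y := by
    intro h'
    have : cycleSet (c * π) y = {y} := by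
      ext v
      refine ⟨fun hv => (hv.eq_of_left (hρy.trans h')).symm, ?_⟩
      rintro rfl
      exact self_mem_cycleSet _ _
    rw [cycleSize, this, Set.ncard_singleton] at hk
    omega
  have hρ : Equiv.swap x y * (Equiv.swap x u * c) * π =
      Equiv.swap y u * (Equiv.swap y ((c * π) y) * (c * π)) := by
    rw [hρy]
    have := congrArg (·⁻¹) (swap_mul_swap_rotate hxy hux huy)
    simp only [mul_inv_rev, Equiv.swap_inv] at this
    rw [← mul_assoc, ← mul_assoc, this, mul_assoc, mul_assoc]
  have hun : unflipRoot ((c, y), π) = ((Equiv.swap x y * (Equiv.swap x u * c), x), π) := by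
    simp only [unflipRoot, hx, hu]
  have e1 : (Equiv.swap x y * (Equiv.swap x u * c)) x = y := by simp [hu]
  rw [hun]
  refine ⟨⟨⟨?_, h.invol, h.ne, ?_⟩, ?_⟩, ?_, ?_⟩
  · have := numCycles_swap_mul_swap_mul (c := c) (x := x) (by rw [hu]; exact hux) hxy.symm
    rw [hu] at this
    exact this.trans h.cycle
  · simp only
    rw [hρ, numCycles_swap_mul_swap_mul (by rw [hρy]; exact hxy) huy, h.euler]
  · simp only
    rw [hρ, hρy]
    have h0 : (Equiv.swap y x * (c * π)) y = y := by simp [hx]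
    have hσ : Equiv.swap y x * (Equiv.swap y x * (c * π)) = c * π := by
      rw [← mul_assoc, Equiv.swap_mul_self, one_mul]
    have h1 := cycleSize_swap_mul h0 hxy
    rw [hσ, ← cycleSize_eq_of_sameCycle hyx, hk] at h1
    rw [cycleSize_swap_mul_of_not_sameCycle h0 huy hxy]
    · omega
    · intro h'
      have h2 := (sameCycle_swap_mul h0 hxy x u).2 (by simpa [hxy, huy] using h')
      rw [hσ] at h2
      exact hloop h2
  · simp only
    rw [e1]
    rintro rfl
    rw [h.invol] at hx
    exact hux (hu.symm.trans hx)
  · have e2 : (Equiv.swap x y * (Equiv.swap x u * c)) (π y) = u := by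
      simp [hx, Equiv.swap_apply_of_ne_of_ne hux huy]
    simp only [flipRoot, e1, e2]
    rw [← mul_assoc (Equiv.swap x y), Equiv.swap_mul_self, one_mul, ← mul_assoc,
      Equiv.swap_mul_self, one_mul]

end Flip

/-! ### Attaching a leaf to the root -/

section Leaf

variable {W : Type*}

theorem sumCongr_one_zpow (σ : Equiv.Perm W) (n : ℤ) :
    (Equiv.Perm.sumCongr σ (1 : Equiv.Perm Bool)) ^ n = Equiv.Perm.sumCongr (σ ^ n) 1 := by
  have := map_zpow (Equiv.Perm.sumCongrHom W Bool) (σ, 1) n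
  simpa [Equiv.Perm.sumCongrHom] using this.symm

theorem sameCycle_sumCongr_inl (σ : Equiv.Perm W) (a : W) (v : W ⊕ Bool) :
    (Equiv.Perm.sumCongr σ (1 : Equiv.Perm Bool)).SameCycle (Sum.inl a) v ↔
      ∃ b, σ.SameCycle a b ∧ v = Sum.inl b := by
  constructor
  · rintro ⟨n, rfl⟩
    exact ⟨(σ ^ n) a, ⟨n, rfl⟩, by simp [sumCongr_one_zpow]⟩
  · rintro ⟨b, ⟨n, rfl⟩, rfl⟩
    exact ⟨n, by simp [sumCongr_one_zpow]⟩

theorem sameCycle_sumCongr_inr (σ : Equiv.Perm W) (i : Bool) (v : W ⊕ Bool) :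
    (Equiv.Perm.sumCongr σ (1 : Equiv.Perm Bool)).SameCycle (Sum.inr i) v ↔ v = Sum.inr i := by
  constructor
  · rintro ⟨n, rfl⟩
    simp [sumCongr_one_zpow]
  · rintro rfl
    exact .refl _ _

theorem numCycles_sumCongr_one [Finite W] (σ : Equiv.Perm W) :
    numCycles (Equiv.Perm.sumCongr σ (1 : Equiv.Perm Bool)) = numCycles σ + 2 := by
  let S := Equiv.Perm.sumCongr σ (1 : Equiv.Perm Bool)
  let F : Quotient (Equiv.Perm.SameCycle.setoid σ) ⊕ Bool →
      Quotient (Equiv.Perm.SameCycle.setoid S) :=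
    Sum.elim (Quotient.map Sum.inl fun a b h => (sameCycle_sumCongr_inl σ a _).2 ⟨b, h, rfl⟩)
      fun i => Quotient.mk _ (Sum.inr i)
  have hF : Function.Bijective F := by
    constructor
    · rintro (p | i) (q | j) h
      · induction p using Quotient.inductionOn with
        | h a =>
        induction q using Quotient.inductionOn with
        | h b =>
        obtain ⟨b', hb, hb'⟩ := (sameCycle_sumCongr_inl σ a _).1
          (Quotient.exact (s := Equiv.Perm.SameCycle.setoid S) h)
        obtain rfl := Sum.inl.inj hb'
        exact congrArg Sum.inl (Quotient.sound (s := Equiv.Perm.SameCycle.setoid σ) hb)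
      · induction p using Quotient.inductionOn with
        | h a =>
        obtain ⟨b', -, hb'⟩ := (sameCycle_sumCongr_inl σ a _).1
          (Quotient.exact (s := Equiv.Perm.SameCycle.setoid S) h)
        exact absurd hb' (by simp)
      · induction q using Quotient.inductionOn with
        | h b =>
        have := (sameCycle_sumCongr_inr σ i _).1
          (Quotient.exact (s := Equiv.Perm.SameCycle.setoid S) h)
        exact absurd this (by simp)
      · have := (sameCycle_sumCongr_inr σ i _).1
          (Quotient.exact (s := Equiv.Perm.SameCycle.setoid S) h)
        exact congrArg Sum.inr (Sum.inr.inj this).symm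
    · intro q
      induction q using Quotient.inductionOn with
      | h v =>
      rcases v with a | i
      · exact ⟨Sum.inl (Quotient.mk _ a), rfl⟩
      · exact ⟨Sum.inr i, rfl⟩
  rw [numCycles, ← Nat.card_congr (Equiv.ofBijective F hF), Nat.card_sum, numCycles]
  simp

theorem cycleSize_sumCongr_one (σ : Equiv.Perm W) (a : W) :
    cycleSize (Equiv.Perm.sumCongr σ (1 : Equiv.Perm Bool)) (Sum.inl a) = cycleSize σ a := by
  have : cycleSet (Equiv.Perm.sumCongr σ (1 : Equiv.Perm Bool)) (Sum.inl a) =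
      Sum.inl '' cycleSet σ a := by
    ext v
    rw [mem_cycleSet, sameCycle_sumCongr_inl]
    exact exists_congr fun b => and_congr_right fun _ => eq_comm
  rw [cycleSize, this, Set.ncard_image_of_injective _ Sum.inl_injective, cycleSize]

variable [DecidableEq W]

/-- The cyclic order `c` with two new sides inserted just before `b`. -/
def insertTwo (c : Equiv.Perm W) (b : W) : Equiv.Perm (W ⊕ Bool) :=
  Equiv.swap (Sum.inr false) (Sum.inr true) *
    (Equiv.swap (Sum.inr true) (Sum.inl b) * Equiv.Perm.sumCongr c 1)

/-- The involution `π` extended by the exchange of the two new sides. -/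
def extendTwo (π : Equiv.Perm W) : Equiv.Perm (W ⊕ Bool) :=
  Equiv.Perm.sumCongr π (Equiv.swap false true)

theorem insertTwo_mul_extendTwo (c π : Equiv.Perm W) (b : W) :
    insertTwo c b * extendTwo π =
      Equiv.swap (Sum.inr false) (Sum.inl b) * Equiv.Perm.sumCongr (c * π) 1 := by
  ext v
  rcases v with w | _ | _
  · by_cases h : c (π w) = b <;> simp [insertTwo, extendTwo, Equiv.swap_apply_def, h]
  · simp [insertTwo, extendTwo, Equiv.swap_apply_def]
  · simp [insertTwo, extendTwo, Equiv.swap_apply_def]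

theorem numCycles_insertTwo [Finite W] (c : Equiv.Perm W) (b : W) :
    numCycles (insertTwo c b) = numCycles c := by
  have h1 := numCycles_swap_mul (τ := Equiv.Perm.sumCongr c (1 : Equiv.Perm Bool))
    (y := Sum.inr true) (a := Sum.inl b) (by simp) (by simp)
  have h2 := numCycles_swap_mul
    (τ := Equiv.swap (Sum.inr true) (Sum.inl b) * Equiv.Perm.sumCongr c (1 : Equiv.Perm Bool))
    (y := Sum.inr false) (a := Sum.inr true) (by simp [Equiv.swap_apply_def]) (by simp)
  rw [numCycles_sumCongr_one] at h1
  rw [insertTwo]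
  omega

theorem isPlane_insertTwo [Finite W] (c π : Equiv.Perm W) (b : W) :
    IsPlane (insertTwo c b) (extendTwo π) ↔ IsPlane c π := by
  have h1 := numCycles_insertTwo c b
  have h2 : numCycles (insertTwo c b * extendTwo π) = numCycles (c * π) + 1 := by
    have := numCycles_swap_mul (τ := Equiv.Perm.sumCongr (c * π) (1 : Equiv.Perm Bool))
      (y := Sum.inr false) (a := Sum.inl b) (by simp) (by simp)
    rw [numCycles_sumCongr_one] at this
    rw [insertTwo_mul_extendTwo]
    omega
  have h3 : Nat.card (W ⊕ Bool) = Nat.card W + 2 := by simp [Nat.card_sum]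
  constructor
  · rintro ⟨a1, a2, a3, a4⟩
    refine ⟨h1 ▸ a1, fun i => ?_, fun i hi => a3 (Sum.inl i) ?_, by omega⟩
    · simpa [extendTwo] using a2 (Sum.inl i)
    · simp [extendTwo, hi]
  · rintro ⟨a1, a2, a3, a4⟩
    refine ⟨h1 ▸ a1, fun i => ?_, fun i => ?_, by omega⟩
    · rcases i with i | _ | _ <;> simp [extendTwo, a2]
    · rcases i with i | _ | _ <;> simp [extendTwo, a3]

theorem cycleSize_insertTwo [Finite W] (c π : Equiv.Perm W) (b : W) :
    cycleSize (insertTwo c b * extendTwo π) (Sum.inr false) = cycleSize (c * π) b + 1 := by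
  rw [insertTwo_mul_extendTwo, ← cycleSize_sumCongr_one (c * π) b,
    ← cycleSize_swap_mul (y := Sum.inr false) (by simp) (by simp)]
  refine cycleSize_eq_of_sameCycle ?_
  have := sameCycle_apply
    (Equiv.swap (Sum.inr false) (Sum.inl b) * Equiv.Perm.sumCongr (c * π) 1) (Sum.inr false)
  simpa using this

/-- The maps whose root edge leads to a leaf arise from the maps with one edge less. -/
theorem leafRootCount_insertTwo [Finite W] (c : Equiv.Perm W) (b : W) (k : ℕ) :
    leafRootCount (insertTwo c b) (Sum.inr false) (k + 1) = rootCount c b k := by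
  have hc : insertTwo c b (Sum.inr false) = Sum.inr true := by
    simp [insertTwo, Equiv.swap_apply_def]
  let F : {π : Equiv.Perm W // IsPlane c π ∧ cycleSize (c * π) b = k} →
      {π : Equiv.Perm (W ⊕ Bool) // IsPlane (insertTwo c b) π ∧
        π (Sum.inr false) = insertTwo c b (Sum.inr false) ∧
        cycleSize (insertTwo c b * π) (Sum.inr false) = k + 1} := fun π =>
    ⟨extendTwo π.1, (isPlane_insertTwo c π.1 b).2 π.2.1, by simp [hc, extendTwo],
      by rw [cycleSize_insertTwo, π.2.2]⟩
  refine (Nat.card_congr (Equiv.ofBijective F ⟨?_, ?_⟩)).symm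
  · intro π π' h
    have h1 : extendTwo π.1 = extendTwo π'.1 := congrArg Subtype.val h
    refine Subtype.ext (Equiv.ext fun w => ?_)
    have := congrArg (fun τ : Equiv.Perm (W ⊕ Bool) => τ (Sum.inl w)) h1
    simpa [extendTwo] using this
  · rintro ⟨π, hπ, hx, hk⟩
    have hx1 : π (Sum.inr false) = Sum.inr true := hx.trans hc
    have hx2 : π (Sum.inr true) = Sum.inr false := by rw [← hx1, hπ.invol]
    have hmaps : Set.MapsTo π (Set.range Sum.inl) (Set.range Sum.inl) := by
      rintro _ ⟨w, rfl⟩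
      rcases hw : π (Sum.inl w) with w' | i
      · exact ⟨w', rfl⟩
      · exfalso
        cases i
        · exact absurd (π.injective (hw.trans hx2.symm)) (by simp)
        · exact absurd (π.injective (hw.trans hx1.symm)) (by simp)
    obtain ⟨⟨π₁, s⟩, hs⟩ := Equiv.Perm.mem_sumCongrHom_range_of_perm_mapsTo_inl hmaps
    have hs' : π = extendTwo π₁ := by
      rw [← hs]
      ext v
      rcases v with w | _ | _
      · simp [extendTwo, Equiv.Perm.sumCongrHom]
      · rw [← hs] at hx1
        simpa [extendTwo, Equiv.Perm.sumCongrHom] using hx1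
      · rw [← hs] at hx2
        simpa [extendTwo, Equiv.Perm.sumCongrHom] using hx2
    subst hs'
    refine ⟨⟨π₁, (isPlane_insertTwo c π₁ b).1 hπ, ?_⟩, rfl⟩
    rw [cycleSize_insertTwo] at hk
    omega

end Leaf

/-! ### Counting by the degree of the root -/

section Count

/-- The number of plane one-face maps with `N + 1` edges whose root vertex has degree `k`. -/
noncomputable def planeCount (N k : ℕ) : ℕ := rootCount (finRotate (2 * N + 1 + 1)) 0 k

theorem rootCount_eq_planeCount {V : Type*} [Finite V] {c : Equiv.Perm V} (hc : numCycles c = 1)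
    {N : ℕ} (hV : Nat.card V = 2 * (N + 1)) (x : V) (k : ℕ) :
    rootCount c x k = planeCount N k := by
  obtain ⟨e, he, hx⟩ := exists_conj_of_numCycles_eq_one hc (numCycles_finRotate (2 * N + 1))
    (by rw [hV, Nat.card_fin]; ring) x 0
  rw [rootCount_conj_equiv e he, hx, planeCount]

theorem leafRootCount_eq_planeCount {V : Type*} [Finite V] {c : Equiv.Perm V}
    (hc : numCycles c = 1) {N : ℕ} (hV : Nat.card V = 2 * (N + 2)) (x : V) (k : ℕ) :
    leafRootCount c x (k + 1) = planeCount N k := by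
  have hd : numCycles (insertTwo (finRotate (2 * N + 1 + 1)) 0) = 1 := by
    rw [numCycles_insertTwo, numCycles_finRotate]
  obtain ⟨e, he, hx⟩ := exists_conj_of_numCycles_eq_one hc hd
    (by rw [hV, Nat.card_sum, Nat.card_fin, Nat.card_eq_fintype_card, Fintype.card_bool]; ring)
    x (Sum.inr false)
  rw [leafRootCount_conj_equiv e he, hx, leafRootCount_insertTwo, planeCount]

/-- The maps whose root has degree `k + 1` either have a leaf at the root edge, or `flipRoot` turns
them into the maps whose root has degree `k + 2`. -/
theorem planeCount_rec (N k : ℕ) :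
    planeCount (N + 1) (k + 1) = planeCount N k + planeCount (N + 1) (k + 2) := by
  classical
  let V := Fin (2 * (N + 1) + 1 + 1)
  have hV : Nat.card V = 2 * (N + 2) := by rw [Nat.card_fin]; ring
  let A : Finset (Equiv.Perm V × V) := Finset.univ.filter fun a => numCycles a.1 = 1
  have hA : 0 < A.card := Finset.card_pos.2
    ⟨(finRotate _, 0), Finset.mem_filter.2 ⟨Finset.mem_univ _, numCycles_finRotate _⟩⟩
  have key : ∀ (P : (Equiv.Perm V × V) × Equiv.Perm V → Prop) (m : ℕ),
      (∀ a π, P (a, π) → numCycles a.1 = 1) →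
      (∀ a : Equiv.Perm V × V, numCycles a.1 = 1 → Nat.card {π // P (a, π)} = m) →
      Nat.card {p // P p} = A.card * m := by
    intro P m h1 h2
    have e : {p // P p} ≃ Σ a : {a : Equiv.Perm V × V // numCycles a.1 = 1}, {π // P (a.1, π)} :=
      { toFun := fun p => ⟨⟨p.1.1, h1 _ _ p.2⟩, ⟨p.1.2, p.2⟩⟩
        invFun := fun q => ⟨(q.1.1, q.2.1), q.2.2⟩
        left_inv := fun _ => rfl
        right_inv := fun _ => rfl }
    rw [Nat.card_congr e, Nat.card_sigma, Finset.sum_congr rfl fun a _ => h2 a.1 a.2,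
      Finset.sum_const, smul_eq_mul, Finset.card_univ, Fintype.card_subtype]
  have hT : ∀ k, Nat.card {p : (Equiv.Perm V × V) × Equiv.Perm V // IsRooted k p} =
      A.card * planeCount (N + 1) k := fun k =>
    key (IsRooted k) _ (fun a π h => h.1.cycle) fun a ha =>
      rootCount_eq_planeCount ha hV a.2 k
  have hL : Nat.card {p : (Equiv.Perm V × V) × Equiv.Perm V //
      IsRooted (k + 1) p ∧ p.2 p.1.2 = p.1.1 p.1.2} = A.card * planeCount N k := by
    refine key (fun p => IsRooted (k + 1) p ∧ p.2 p.1.2 = p.1.1 p.1.2) _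
      (fun a π h => h.1.1.cycle) fun a ha => ?_
    rw [← leafRootCount_eq_planeCount ha hV a.2 k]
    exact Nat.card_congr (Equiv.subtypeEquivRight fun π => by
      simp only [IsRooted]
      tauto)
  have hF : Nat.card {p : (Equiv.Perm V × V) × Equiv.Perm V //
      IsRooted (k + 1) p ∧ ¬ p.2 p.1.2 = p.1.1 p.1.2} = A.card * planeCount (N + 1) (k + 2) := by
    rw [← hT]
    exact Nat.card_congr
      { toFun := fun p => ⟨flipRoot p.1, (flipRoot_spec p.2.1 p.2.2).1⟩
        invFun := fun p => ⟨unflipRoot p.1, (unflipRoot_spec p.2).1, (unflipRoot_spec p.2).2.1⟩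
        left_inv := fun p => Subtype.ext (flipRoot_spec p.2.1 p.2.2).2
        right_inv := fun p => Subtype.ext (unflipRoot_spec p.2).2.2 }
  have hsplit : Nat.card {p : (Equiv.Perm V × V) × Equiv.Perm V // IsRooted (k + 1) p} =
      Nat.card {p : (Equiv.Perm V × V) × Equiv.Perm V //
        IsRooted (k + 1) p ∧ p.2 p.1.2 = p.1.1 p.1.2} +
      Nat.card {p : (Equiv.Perm V × V) × Equiv.Perm V //
        IsRooted (k + 1) p ∧ ¬ p.2 p.1.2 = p.1.1 p.1.2} := by
    simp only [Nat.card_eq_fintype_card, Fintype.card_subtype]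
    rw [← Finset.filter_filter, ← Finset.filter_filter, Finset.card_filter_add_card_filter_not]
  rw [hT, hL, hF, ← mul_add] at hsplit
  exact Nat.eq_of_mul_eq_mul_left hA hsplit

theorem planeCount_eq_zero_of_card_lt {N k : ℕ} (h : 2 * (N + 1) < k) : planeCount N k = 0 := by
  refine Nat.card_eq_zero.2 (Or.inl ⟨fun π => ?_⟩)
  have := cycleSize_le_card (finRotate (2 * N + 1 + 1) * π.1) 0
  rw [π.2.2, Nat.card_fin] at this
  omega

theorem planeCount_zero_right (N : ℕ) : planeCount N 0 = 0 :=
  Nat.card_eq_zero.2 (Or.inl ⟨fun π => (cycleSize_pos _ _).ne' π.2.2⟩)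

/-- All maps with `N + 1` edges, counted through the maps with one more edge and a root of
degree `1`. -/
theorem sum_planeCount (N : ℕ) :
    ∑ k ∈ Finset.range (2 * N + 3), planeCount N k = planeCount (N + 1) 1 := by
  have h : ∀ m, ∑ k ∈ Finset.range m, planeCount N k + planeCount (N + 1) (m + 1) =
      planeCount (N + 1) 1 := by
    intro m
    induction m with
    | zero => simp
    | succ m ih =>
      rw [Finset.sum_range_succ, add_assoc, ← ih, planeCount_rec N m]
  have h1 := h (2 * N + 5)
  rw [planeCount_eq_zero_of_card_lt (by omega), Finset.sum_range_succ, Finset.sum_range_succ,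
    planeCount_eq_zero_of_card_lt (k := 2 * N + 3) (by omega),
    planeCount_eq_zero_of_card_lt (k := 2 * N + 3 + 1) (by omega)] at h1
  simpa using h1

end Count

/-! ### Ballot numbers and the limiting degree distribution of the root -/

section Asymptotics

theorem planeCount_zero (k : ℕ) : planeCount 0 k = if k = 1 then 1 else 0 := by
  have h0 : ∀ π : Equiv.Perm (Fin (2 * 0 + 1 + 1)), (∀ i, π i ≠ i) → π = Equiv.swap 0 1 := by
    decide
  have h1 : finRotate (2 * 0 + 1 + 1) * Equiv.swap (0 : Fin (2 * 0 + 1 + 1)) 1 = 1 := by decide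
  have hset : ∀ x : Fin (2 * 0 + 1 + 1), cycleSet 1 x = {x} := by
    intro x
    ext y
    simp [mem_cycleSet, eq_comm]
  have hnum : numCycles (1 : Equiv.Perm (Fin (2 * 0 + 1 + 1))) = 2 := by
    have h2 := numCycles_swap_mul (τ := (1 : Equiv.Perm (Fin (2 * 0 + 1 + 1)))) (y := 0) (a := 1)
      rfl (by decide)
    have h3 : Equiv.swap (0 : Fin (2 * 0 + 1 + 1)) 1 * 1 = finRotate (2 * 0 + 1 + 1) := by decide
    rw [h3, numCycles_finRotate] at h2
    exact h2.symm
  have hplane : IsPlane (finRotate (2 * 0 + 1 + 1)) (Equiv.swap 0 1) :=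
    ⟨numCycles_finRotate _, by decide, by decide, by rw [h1, hnum]; simp⟩
  have hsize : cycleSize (finRotate (2 * 0 + 1 + 1) * Equiv.swap 0 1) 0 = 1 := by
    rw [h1, cycleSize, hset, Set.ncard_singleton]
  split_ifs with hk
  · subst hk
    refine Nat.card_eq_one_iff_unique.2 ⟨⟨fun π π' => Subtype.ext ?_⟩, ⟨_, hplane, hsize⟩⟩
    rw [h0 _ π.2.1.ne, h0 _ π'.2.1.ne]
  · refine Nat.card_eq_zero.2 (Or.inl ⟨fun π => hk ?_⟩)
    rw [← π.2.2, h0 _ π.2.1.ne, hsize]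

theorem planeCount_eq_zero {N k : ℕ} (h : N + 1 < k) : planeCount N k = 0 := by
  induction N generalizing k with
  | zero => rw [planeCount_zero, if_neg (by omega)]
  | succ N ih =>
    obtain ⟨k, rfl⟩ : ∃ j, k = j + 1 := ⟨k - 1, by omega⟩
    -- by the recursion the count does not change as `k` grows, and it vanishes eventually
    have h1 : ∀ j, planeCount (N + 1) (k + 1) = planeCount (N + 1) (k + 1 + j) := by
      intro j
      induction j with
      | zero => rfl
      | succ j ihj =>
        rw [ihj, show k + 1 + j = k + j + 1 by ring, planeCount_rec, ih (by omega), zero_add]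
        exact congrArg _ (by ring)
    rw [h1 (2 * (N + 2)), planeCount_eq_zero_of_card_lt (by omega)]

/-- The ballot numbers: the number of plane maps with `m + k + 1` edges and a root of degree
`k + 1` is `(k + 1) (2m + k)! / ((m + k + 1)! m!)`. -/
theorem planeCount_mul_factorial (m k : ℕ) :
    planeCount (m + k) (k + 1) * ((m + k + 1).factorial * m.factorial) =
      (k + 1) * (2 * m + k).factorial := by
  induction m generalizing k with
  | zero =>
    induction k with
    | zero => simp [planeCount_zero]
    | succ k ih =>
      have h := planeCount_rec (0 + k) (k + 1)
      rw [planeCount_eq_zero (k := k + 1 + 2) (by omega), add_zero] at h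
      have e : 0 + (k + 1) = 0 + k + 1 := by ring
      rw [e, h]
      simp only [Nat.factorial_zero, mul_one, mul_zero, zero_add, Nat.factorial_succ] at ih ⊢
      have hpos : 0 < k.factorial := Nat.factorial_pos k
      have : planeCount k (k + 1) = 1 := by
        have h2 : planeCount k (k + 1) * ((k + 1) * k.factorial) = 1 * ((k + 1) * k.factorial) := by
          rw [ih, one_mul]
        exact Nat.eq_of_mul_eq_mul_right (by positivity) h2
      rw [this]
      ring
  | succ m ihm =>
    induction k with
    | zero =>
      have h := planeCount_rec m 0
      rw [planeCount_zero_right, zero_add] at h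
      have h2 := ihm 1
      simp only [add_zero, zero_add] at h ⊢
      rw [h]
      have e : 2 * (m + 1) = 2 * m + 1 + 1 := by ring
      rw [e, Nat.factorial_succ (2 * m + 1), Nat.factorial_succ m]
      calc _ = planeCount (m + 1) 2 * ((m + 1 + 1).factorial * m.factorial) * (m + 1) := by ring
        _ = _ := by
          rw [h2]
          ring
    | succ k ihk =>
      have h := planeCount_rec (m + 1 + k) (k + 1)
      have h2 := ihm (k + 2)
      have e1 : m + (k + 2) = m + 1 + k + 1 := by ring
      have e2 : 2 * m + (k + 2) = 2 * (m + 1) + k := by ring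
      rw [e1, e2] at h2
      have e3 : m + 1 + (k + 1) = m + 1 + k + 1 := by ring
      have e4 : 2 * (m + 1) + (k + 1) = 2 * (m + 1) + k + 1 := by ring
      rw [e3, e4, h]
      rw [Nat.factorial_succ (m + 1 + k + 1), Nat.factorial_succ (2 * (m + 1) + k)]
      rw [Nat.factorial_succ (m + 1 + k + 1)] at h2
      rw [Nat.factorial_succ m] at ihk ⊢
      generalize (2 * (m + 1) + k).factorial = f at *
      generalize (m + 1 + k + 1).factorial = g at *
      generalize m.factorial = l at *
      generalize planeCount (m + 1 + k) (k + 1) = p at *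
      have e5 : k + 1 + 2 = k + 2 + 1 := by ring
      rw [e5]
      generalize planeCount (m + 1 + k + 1) (k + 2 + 1) = q at *
      calc _ = p * (g * ((m + 1) * l)) * (m + 1 + k + 1 + 1) +
            q * ((m + 1 + k + 1 + 1) * g * l) * (m + 1) := by ring
        _ = _ := by
          rw [ihk, h2]
          ring

/-- `planeCount N 1` is a Catalan number. -/
theorem planeCount_one_mul_factorial (N : ℕ) :
    planeCount N 1 * ((N + 1).factorial * N.factorial) = (2 * N).factorial := by
  simpa using planeCount_mul_factorial N 0

theorem planeCount_one_pos (N : ℕ) : 0 < planeCount N 1 := by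
  refine Nat.pos_of_ne_zero fun h => ?_
  have := planeCount_one_mul_factorial N
  rw [h, zero_mul] at this
  exact (Nat.factorial_pos _).ne this

theorem planeCount_one_succ (N : ℕ) :
    planeCount (N + 1) 1 * (N + 2) = planeCount N 1 * (2 * (2 * N + 1)) := by
  have h1 := planeCount_one_mul_factorial N
  have h2 := planeCount_one_mul_factorial (N + 1)
  have e : 2 * (N + 1) = 2 * N + 1 + 1 := by ring
  rw [e, Nat.factorial_succ (2 * N + 1), Nat.factorial_succ (2 * N), ← h1,
    Nat.factorial_succ (N + 1)] at h2
  have hpos : 0 < (N + 1).factorial * N.factorial * (N + 1) := by positivity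
  refine Nat.eq_of_mul_eq_mul_right hpos ?_
  rw [Nat.factorial_succ N] at h2 ⊢
  linarith

theorem tendsto_planeCount_one_ratio :
    Tendsto (fun N : ℕ => (planeCount N 1 : ℝ) / planeCount (N + 1) 1) atTop (𝓝 (1 / 4)) := by
  have h : ∀ N : ℕ, (planeCount N 1 : ℝ) / planeCount (N + 1) 1 =
      1 / 4 + 3 / 4 * (1 / (2 * (N : ℝ) + 1)) := by
    intro N
    have h1 : (planeCount (N + 1) 1 : ℝ) * (N + 2) = planeCount N 1 * (2 * (2 * N + 1)) := by
      exact_mod_cast planeCount_one_succ N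
    have h2 : (planeCount (N + 1) 1 : ℝ) ≠ 0 := by exact_mod_cast (planeCount_one_pos _).ne'
    have h3 : (2 * (N : ℝ) + 1) ≠ 0 := by positivity
    field_simp
    linarith
  simp_rw [h]
  have h4 : Tendsto (fun N : ℕ => 1 / (2 * (N : ℝ) + 1)) atTop (𝓝 0) := by
    refine tendsto_const_nhds.div_atTop (tendsto_atTop_add_const_right _ _ ?_)
    exact tendsto_natCast_atTop_atTop.const_mul_atTop (by norm_num)
  simpa using (h4.const_mul (3 / 4 : ℝ)).const_add (1 / 4 : ℝ)

/-- The degree of the root of a random plane map has the limiting distribution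
`k ↦ k / 2 ^ (k + 1)`. -/
theorem tendsto_planeCount_div (k : ℕ) :
    Tendsto (fun N : ℕ => (planeCount N k : ℝ) / planeCount (N + 1) 1) atTop
      (𝓝 (k / 2 ^ (k + 1))) := by
  induction k using Nat.strong_induction_on with
  | _ k ih =>
    match k with
    | 0 => simp [planeCount_zero_right]
    | 1 =>
      convert tendsto_planeCount_one_ratio using 2
      norm_num
    | k + 2 =>
      rw [← tendsto_add_atTop_iff_nat 1]
      have h1 := (tendsto_add_atTop_iff_nat 1).2 (ih (k + 1) (by omega))
      have h2 := (ih k (by omega)).mul ((tendsto_add_atTop_iff_nat 1).2 tendsto_planeCount_one_ratio)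
      convert h1.sub h2 using 1
      · ext N
        have h3 : (planeCount (N + 1) (k + 1) : ℝ) =
            planeCount N k + planeCount (N + 1) (k + 2) := by
          exact_mod_cast planeCount_rec N k
        have h4 : (planeCount (N + 1) 1 : ℝ) ≠ 0 := by exact_mod_cast (planeCount_one_pos _).ne'
        rw [div_mul_div_cancel₀ h4, h3]
        ring
      · congr 1
        push_cast
        field_simp
        ring

end Asymptotics

/-! ### Points and cycles -/

section Fibers

variable {V : Type*}

/-- The cycles of length `k` contain `k` points each. -/
theorem mul_ncard_cycles [Finite V] (σ : Equiv.Perm V)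
    (D : Quotient (Equiv.Perm.SameCycle.setoid σ) → ℕ)
    (hD : ∀ i, D (Quotient.mk _ i) = cycleSize σ i) (k : ℕ) :
    k * {v | D v = k}.ncard = {i | cycleSize σ i = k}.ncard := by
  classical
  have : Fintype V := Fintype.ofFinite V
  have : Fintype (Quotient (Equiv.Perm.SameCycle.setoid σ)) := Fintype.ofFinite _
  let s : Finset V := Finset.univ.filter fun i => cycleSize σ i = k
  let t : Finset (Quotient (Equiv.Perm.SameCycle.setoid σ)) := Finset.univ.filter fun v => D v = k
  have hs : {i | cycleSize σ i = k} = (s : Set V) := by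
    ext
    simp [s]
  have ht : {v | D v = k} = (t : Set _) := by
    ext
    simp [t]
  rw [hs, ht, Set.ncard_coe_finset, Set.ncard_coe_finset,
    Finset.card_eq_sum_card_fiberwise (f := Quotient.mk (Equiv.Perm.SameCycle.setoid σ)) (t := t)
      fun i hi => by
        simp only [s, t, Finset.coe_filter, Finset.mem_univ, true_and, Set.mem_ofPred_eq] at hi ⊢
        rw [hD, hi]]
  rw [Finset.sum_const_nat (m := k), mul_comm]
  intro v hv
  obtain ⟨i, rfl⟩ := Quotient.exists_rep v
  have hi : cycleSize σ i = k := by simpa [t, hD] using hv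
  rw [← hi, cycleSize, ← Set.ncard_coe_finset]
  congr 1
  ext j
  simp only [s, Finset.coe_filter, Finset.mem_filter, Finset.mem_univ, true_and, Set.mem_ofPred_eq,
    mem_cycleSet]
  constructor
  · rintro ⟨-, h⟩
    exact (Quotient.exact (s := Equiv.Perm.SameCycle.setoid σ) h).symm
  · intro h
    exact ⟨(cycleSize_eq_of_sameCycle h).symm.trans hi,
      Quotient.sound (s := Equiv.Perm.SameCycle.setoid σ) h.symm⟩

end Fibers

/-! ### Genus zero: trees, faces and cycles -/

namespace Pairing

variable {N : ℕ}

theorem pos_of_eulerChar {π : Pairing N} (h : π.eulerChar = 2) : 0 < N := by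
  rcases Nat.eq_zero_or_pos N with rfl | h0
  · have : Nat.card π.MapVertex = 0 := by
      rw [MapVertex, Nat.card_eq_zero]
      exact Or.inl ⟨fun q => Quotient.inductionOn q fun i : Fin 0 => i.elim0⟩
    simp [eulerChar, this] at h
  · exact h0

theorem numCycles_finRotate_two_mul (h : 0 < N) : numCycles (finRotate (2 * N)) = 1 := by
  obtain ⟨m, rfl⟩ := Nat.exists_eq_succ_of_ne_zero h.ne'
  exact numCycles_finRotate (2 * m + 1)

theorem finRotate_ne (i : Fin (2 * N)) : finRotate (2 * N) i ≠ i := by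
  have hN : 0 < N := by
    have := i.isLt
    omega
  exact apply_ne_of_numCycles_eq_one (numCycles_finRotate_two_mul hN)
    (by rw [Nat.card_fin]; omega) i

/-- Genus zero in terms of permutations. -/
theorem eulerChar_eq_two_iff {π : Pairing N} (h : 0 < N) :
    π.eulerChar = 2 ↔ IsPlane (finRotate (2 * N)) π.perm := by
  have h1 : Nat.card π.MapVertex = numCycles (finRotate (2 * N) * π.perm) := rfl
  have h2 : Nat.card (Fin (2 * N)) = 2 * N := Nat.card_fin _
  constructor
  · intro hπ
    refine ⟨numCycles_finRotate_two_mul h, π.perm_perm, π.perm_ne, ?_⟩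
    rw [eulerChar, h1] at hπ
    omega
  · intro hπ
    have := hπ.euler
    rw [eulerChar, h1]
    omega

theorem corner_eq_corner {π : Pairing N} {i j : Fin (2 * N)} :
    π.corner i = π.corner j ↔ (finRotate (2 * N) * π.perm).SameCycle i j :=
  ⟨fun h => Quotient.exact (s := π.cornerSetoid) h, fun h => Quotient.sound (s := π.cornerSetoid) h⟩

theorem exists_corner {π : Pairing N} (v : π.MapVertex) : ∃ i, π.corner i = v :=
  Quotient.exists_rep v

theorem corner_perm (π : Pairing N) (i) :
    π.corner (π.perm i) = π.corner (finRotate (2 * N) i) := by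
  rw [← π.corner_glue (π.perm i), perm_perm]

instance (π : Pairing N) : Finite π.MapVertex :=
  inferInstanceAs (Finite (Quotient π.cornerSetoid))

instance (π : Pairing N) : Finite π.Face :=
  inferInstanceAs (Finite (Quotient (Equiv.Perm.SameCycle.setoid π.facePerm)))

section GenusZero

variable {π : Pairing N}

theorem isPlane_of_eulerChar (h : π.eulerChar = 2) : IsPlane (finRotate (2 * N)) π.perm :=
  (eulerChar_eq_two_iff (pos_of_eulerChar h)).1 h

/-- The embedded graph has no loops. -/
theorem corner_finRotate_ne (h : π.eulerChar = 2) (i) :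
    π.corner (finRotate (2 * N) i) ≠ π.corner i := fun h' =>
  (isPlane_of_eulerChar h).not_sameCycle i (corner_eq_corner.1 h').symm

theorem eq_of_sym2_eq (h : π.eulerChar = 2) {i j : Fin (2 * N)}
    (hij : s(i, π.perm i) = s(j, π.perm j)) (hc : π.corner i = π.corner j) : i = j := by
  rcases Sym2.eq_iff.1 hij with ⟨h', -⟩ | ⟨h', -⟩
  · exact h'
  · rw [h', corner_perm] at hc
    exact absurd hc (corner_finRotate_ne h j)

theorem isTree_embeddedGraph (h : π.eulerChar = 2) : IsTree π.embeddedGraph := by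
  have hP := isPlane_of_eulerChar h
  have hN := pos_of_eulerChar h
  refine ⟨⟨π.corner ⟨0, by omega⟩, trivial⟩, fun u _ v _ => ?_, fun r F hF => ?_⟩
  · obtain ⟨i, rfl⟩ := exists_corner u
    obtain ⟨j, rfl⟩ := exists_corner v
    have hsymm : ∀ a b, Relation.ReflTransGen π.embeddedGraph.Adj a b →
        Relation.ReflTransGen π.embeddedGraph.Adj b a := fun a b h => by
      induction h with
      | refl => exact .refl
      | tail _ h ih => exact ih.head h.symm
    refine rel_of_sameCycle (σ := finRotate (2 * N))
      (r := fun i j => Relation.ReflTransGen π.embeddedGraph.Adj (π.corner i) (π.corner j))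
      ⟨fun _ => .refl, fun h => hsymm _ _ h,
        fun h h' => h.trans h'⟩
      (fun i => .single ⟨s(i, π.perm i), i, rfl, rfl, rfl⟩)
      (sameCycle_of_numCycles_eq_one hP.cycle i j)
  · obtain ⟨hr, v, e, hw, -, he, -⟩ := hF
    obtain ⟨r, rfl⟩ := Nat.exists_eq_succ_of_ne_zero hr.ne'
    obtain ⟨i₀, he₀, hv₀, hv₁⟩ := hw (Fin.last r)
    obtain ⟨R, hR, hglue, hside, hsep⟩ := hP.exists_equivalence i₀
    have hcorner : ∀ i j, π.corner i = π.corner j → R i j := fun i j hij =>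
      rel_of_sameCycle hR hglue (corner_eq_corner.1 hij)
    -- the other edges of the cycle connect its vertices
    have key : ∀ k : Fin (r + 1), ∀ i j, π.corner i = v 0 → π.corner j = v k → R i j := by
      intro k
      induction k using Fin.induction with
      | zero => exact fun i j hi hj => hcorner i j (hi.trans hj.symm)
      | succ k ih =>
        intro i j hi hj
        obtain ⟨a, ha, hva, hvb⟩ := hw k.castSucc
        have hk : finRotate (r + 1) k.castSucc = k.succ := by simp
        rw [hk] at hvb
        refine hR.trans (ih i a hi hva.symm) (hR.trans (hside a ?_ ?_)
          (hcorner _ _ (hvb.symm.trans hj.symm)))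
        · rintro rfl
          exact Fin.castSucc_ne_last k (he (ha.trans he₀.symm))
        · rintro rfl
          rw [perm_perm, Sym2.eq_swap] at ha
          exact Fin.castSucc_ne_last k (he (ha.trans he₀.symm))
    have hlast : finRotate (r + 1) (Fin.last r) = 0 := finRotate_last
    rw [hlast] at hv₁
    exact hsep (hR.symm (key (Fin.last r) _ _ hv₁.symm hv₀.symm))

/-- Each corner at a vertex of the tree starts exactly one edge. -/
theorem degree_embeddedGraph (h : π.eulerChar = 2) (i) :
    degree π.embeddedGraph (π.corner i) = cycleSize (finRotate (2 * N) * π.perm) i := by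
  have h1 : π.embeddedGraph.loopSet (π.corner i) = ∅ := by
    refine Set.eq_empty_of_forall_notMem ?_
    rintro e ⟨j, -, h1, h2⟩
    exact corner_finRotate_ne h j (h2.symm.trans h1)
  have h2 : π.embeddedGraph.incidenceSet (π.corner i) =
      (fun j => s(j, π.perm j)) '' cycleSet (finRotate (2 * N) * π.perm) i := by
    ext e
    constructor
    · rintro ⟨-, j, rfl, h1, -⟩
      exact ⟨j, corner_eq_corner.1 h1, rfl⟩
    · rintro ⟨j, hj, rfl⟩
      exact ⟨_, j, rfl, corner_eq_corner.2 hj, rfl⟩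
  rw [degree, h1, h2, Set.ncard_empty, add_zero, Set.InjOn.ncard_image, cycleSize]
  intro j hj k hk hjk
  exact eq_of_sym2_eq h hjk (corner_eq_corner.2 (hj.symm.trans hk))

end GenusZero

/-! ### The faces of the drawing -/

section Faces

variable (π : Pairing N)

theorem facePerm_zero (i) : π.facePerm (i, 0) = (finRotate (2 * N) i, 1) := by
  simp [facePerm, reverse, reverseFun, rotation, Equiv.Perm.mul_apply, Equiv.Perm.inv_def]

theorem facePerm_one (i) : π.facePerm (i, 1) = (π.perm i, 0) := by
  simp [facePerm, reverse, reverseFun, rotation, Equiv.Perm.mul_apply, Equiv.Perm.inv_def]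

theorem facePerm_two (i) : π.facePerm (i, 2) = ((finRotate (2 * N)).symm i, 2) := by
  have : (finRotate 3).symm 0 = 2 := by decide
  simp [facePerm, reverse, reverseFun, rotation, Equiv.Perm.mul_apply, Equiv.Perm.inv_def,
    -finRotate_symm_apply, this]

/-- The vertex of the embedded graph inside the face to the left of a dart, and `none` for the
infinite face. -/
def label : Dart N → Option π.MapVertex
  | (i, 0) => some (π.corner (finRotate (2 * N) i))
  | (i, 1) => some (π.corner i)
  | (_, 2) => none

theorem label_facePerm (d : Dart N) : π.label (π.facePerm d) = π.label d :=
  match d with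
  | (i, 0) => by rw [facePerm_zero]; rfl
  | (i, 1) => by rw [facePerm_one]; exact congrArg some (π.corner_glue i)
  | (i, 2) => by rw [facePerm_two]; rfl

theorem sameCycle_facePerm_of_corner {i j : Fin (2 * N)} (h : π.corner i = π.corner j) :
    π.facePerm.SameCycle (i, 1) (j, 1) := by
  refine rel_of_sameCycle (r := fun i j => π.facePerm.SameCycle (i, 1) (j, 1))
    ⟨fun _ => .refl _ _, fun h => h.symm, fun h h' => h.trans h'⟩ (fun i => ?_)
    (corner_eq_corner.1 h)
  refine ⟨2, ?_⟩
  simp [zpow_ofNat, pow_two, Equiv.Perm.mul_apply, facePerm_one, facePerm_zero]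

theorem sameCycle_facePerm_iff (d d' : Dart N) :
    π.facePerm.SameCycle d d' ↔ π.label d = π.label d' := by
  refine ⟨fun h => eq_of_sameCycle π.label_facePerm h, fun h => ?_⟩
  have h01 : ∀ i, π.facePerm.SameCycle (i, 0) (finRotate (2 * N) i, 1) := fun i => by
    rw [← facePerm_zero]
    exact sameCycle_apply _ _
  have h2 : ∀ i j, π.facePerm.SameCycle (i, 2) (j, 2) := by
    intro i j
    have hN : 0 < N := by
      have := i.isLt
      omega
    refine rel_of_sameCycle (σ := finRotate (2 * N))
      (r := fun i j => π.facePerm.SameCycle (i, 2) (j, 2))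
      ⟨fun _ => .refl _ _, fun h => h.symm, fun h h' => h.trans h'⟩ (fun i => ?_)
      (sameCycle_of_numCycles_eq_one (numCycles_finRotate_two_mul hN) i j)
    have := sameCycle_apply π.facePerm (finRotate (2 * N) i, 2)
    rw [facePerm_two, Equiv.symm_apply_apply] at this
    exact this.symm
  obtain ⟨i, t⟩ := d
  obtain ⟨j, s⟩ := d'
  fin_cases t <;> fin_cases s
  · exact (h01 i).trans ((π.sameCycle_facePerm_of_corner (Option.some.inj h)).trans (h01 j).symm)
  · exact (h01 i).trans (π.sameCycle_facePerm_of_corner (Option.some.inj h))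
  · exact absurd h (by simp [label])
  · exact (π.sameCycle_facePerm_of_corner (Option.some.inj h)).trans (h01 j).symm
  · exact π.sameCycle_facePerm_of_corner (Option.some.inj h)
  · exact absurd h (by simp [label])
  · exact absurd h (by simp [label])
  · exact absurd h (by simp [label])
  · exact h2 i j

theorem faceOf_eq_faceOf (d d' : Dart N) : π.faceOf d = π.faceOf d' ↔ π.label d = π.label d' :=
  Iff.trans ⟨fun h => Quotient.exact (s := Equiv.Perm.SameCycle.setoid π.facePerm) h,
    fun h => Quotient.sound (s := Equiv.Perm.SameCycle.setoid π.facePerm) h⟩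
    (π.sameCycle_facePerm_iff d d')

theorem exists_faceOf (f : π.Face) : ∃ d, π.faceOf d = f := Quotient.exists_rep f

/-- Every face is the infinite face or surrounds exactly one vertex of the embedded graph. -/
def faceLabel : π.Face → Option π.MapVertex :=
  Quotient.lift π.label fun d d' h => (π.sameCycle_facePerm_iff d d').1 h

theorem faceLabel_injective : Function.Injective π.faceLabel := by
  intro f g h
  obtain ⟨d, rfl⟩ := π.exists_faceOf f
  obtain ⟨d', rfl⟩ := π.exists_faceOf g
  exact (π.faceOf_eq_faceOf d d').2 h

theorem faceLabel_surjective (hN : 0 < N) : Function.Surjective π.faceLabel := by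
  rintro (_ | v)
  · exact ⟨π.faceOf (⟨0, by omega⟩, 2), rfl⟩
  · obtain ⟨i, rfl⟩ := exists_corner v
    exact ⟨π.faceOf (i, 1), rfl⟩

theorem card_face (hN : 0 < N) : Nat.card π.Face = Nat.card π.MapVertex + 1 := by
  rw [Nat.card_congr (Equiv.ofBijective _ ⟨π.faceLabel_injective, π.faceLabel_surjective hN⟩),
    Finite.card_option]

theorem isSome_faceLabel (f : π.InternalFace) : (π.faceLabel f.1).isSome := by
  obtain ⟨f, hf⟩ := f
  obtain ⟨⟨i, t⟩, rfl⟩ := π.exists_faceOf f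
  fin_cases t
  · rfl
  · rfl
  · exact absurd rfl (hf i)

/-- The internal faces correspond to the vertices that they surround. -/
noncomputable def internalFaceEquiv : π.InternalFace ≃ π.MapVertex :=
  Equiv.ofBijective (fun f => (π.faceLabel f.1).get (π.isSome_faceLabel f)) (by
    constructor
    · intro f g h
      exact Subtype.ext (π.faceLabel_injective (Option.get_inj.1 h))
    · intro v
      obtain ⟨i, rfl⟩ := exists_corner v
      refine ⟨⟨π.faceOf (i, 1), fun j h => ?_⟩, rfl⟩
      exact absurd ((π.faceOf_eq_faceOf _ _).1 h) (by simp [label]))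

theorem faceLabel_eq_some (f : π.InternalFace) :
    π.faceLabel f.1 = some (π.internalFaceEquiv f) :=
  (Option.some_get (π.isSome_faceLabel f)).symm

/-- The darts along the boundary of the face around the vertex at the corner `j`: the circle edges
that end at the corners of the vertex, and the chords that start there. -/
theorem setOf_label_eq (j : Fin (2 * N)) :
    {d | π.label d = some (π.corner j)} =
      (fun i => ((finRotate (2 * N)).symm i, (0 : Fin 3))) ''
        cycleSet (finRotate (2 * N) * π.perm) j ∪
      (fun i => (i, (1 : Fin 3))) '' cycleSet (finRotate (2 * N) * π.perm) j := by
  ext ⟨i, t⟩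
  simp only [Set.mem_ofPred_eq, Set.mem_union, Set.mem_image, mem_cycleSet, ← corner_eq_corner,
    Prod.mk.injEq]
  fin_cases t
  · constructor
    · intro h
      exact Or.inl ⟨finRotate (2 * N) i, (Option.some.inj h).symm, Equiv.symm_apply_apply _ _, rfl⟩
    · rintro (⟨k, h1, h2, -⟩ | ⟨k, -, -, h⟩)
      · rw [← h2]
        exact congrArg some ((congrArg π.corner (Equiv.apply_symm_apply _ k)).trans h1.symm)
      · exact absurd h (by decide)
  · constructor
    · intro h
      exact Or.inr ⟨i, (Option.some.inj h).symm, rfl, rfl⟩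
    · rintro (⟨k, -, -, h⟩ | ⟨k, h1, h2, -⟩)
      · exact absurd h (by decide)
      · rw [← h2]
        exact congrArg some h1.symm
  · constructor
    · intro h
      exact absurd h (by simp [label])
    · rintro (⟨k, -, -, h⟩ | ⟨k, -, -, h⟩) <;> exact absurd h (by decide)

theorem ncard_setOf_label_eq (j : Fin (2 * N)) :
    {d | π.label d = some (π.corner j)}.ncard =
      2 * cycleSize (finRotate (2 * N) * π.perm) j := by
  rw [setOf_label_eq, Set.ncard_union_eq _ (Set.toFinite _) (Set.toFinite _),
    Set.ncard_image_of_injective, Set.ncard_image_of_injective, cycleSize]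
  · ring
  · intro a b h
    exact (Prod.mk.inj h).1
  · intro a b h
    exact (finRotate (2 * N)).symm.injective (Prod.mk.inj h).1
  · rw [Set.disjoint_left]
    rintro _ ⟨a, -, rfl⟩ ⟨b, -, h⟩
    exact absurd (Prod.mk.inj h).2 (by decide)

theorem isLink_dartEdge (d : Dart N) :
    π.cubicGraph.IsLink (π.dartEdge d) d.1 (π.facePerm d).1 := by
  obtain ⟨i, t⟩ := d
  fin_cases t
  · rw [show ((⟨0, by decide⟩ : Fin 3)) = 0 from rfl, facePerm_zero]
    rfl
  · rw [show ((⟨1, by decide⟩ : Fin 3)) = 1 from rfl, facePerm_one]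
    exact ⟨rfl, rfl⟩
  · rw [show ((⟨2, by decide⟩ : Fin 3)) = 2 from rfl, facePerm_two]
    refine Eq.trans ?_ Sym2.eq_swap
    exact congrArg (fun a => s(_, a)) (Equiv.apply_symm_apply _ i)

theorem setOf_faceOf_eq {d : Dart N} {v : π.MapVertex} (hd : π.label d = some v) :
    {d' | π.faceOf d' = π.faceOf d} = {d' | π.label d' = some v} := by
  ext d'
  simp only [Set.mem_ofPred_eq, faceOf_eq_faceOf, hd]

variable {π}

/-- The boundary of the face around a vertex of degree `d` is a cycle of length `2d`. -/
theorem isCycle_faceBoundary (h : π.eulerChar = 2) (i : Fin (2 * N)) :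
    IsCycle π.cubicGraph (2 * cycleSize (finRotate (2 * N) * π.perm) i)
      (π.faceBoundary (π.faceOf (i, 1))) := by
  obtain ⟨f, hf, hfr, hfc, -⟩ := exists_enum_cycle π.facePerm (i, 1)
  have hset : cycleSet π.facePerm (i, 1) = {d | π.label d = some (π.corner i)} := by
    ext d
    rw [mem_cycleSet, sameCycle_facePerm_iff]
    exact eq_comm
  have hsize : cycleSize π.facePerm (i, 1) = 2 * cycleSize (finRotate (2 * N) * π.perm) i := by
    rw [cycleSize, hset, ncard_setOf_label_eq]
  rw [← hsize]
  have hmem : ∀ k, π.label (f k) = some (π.corner i) := fun k => by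
    have : f k ∈ cycleSet π.facePerm (i, 1) := hfr ▸ Set.mem_range_self k
    rwa [hset] at this
  refine ⟨cycleSize_pos _ _, fun k => (f k).1, fun k => π.dartEdge (f k), fun k => ?_, ?_, ?_, ?_⟩
  · have := π.isLink_dartEdge (f k)
    rw [← hfc] at this
    exact this
  · intro k l hkl
    refine hf ?_
    have hk := hmem k
    have hl := hmem l
    simp only at hkl
    revert hkl hk hl
    rcases f k with ⟨a, s⟩
    rcases f l with ⟨b, t⟩
    rintro rfl hk hl
    have e := hk.trans hl.symm
    have hloop := corner_finRotate_ne h a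
    fin_cases s <;> fin_cases t
    · rfl
    · exact absurd (Option.some.inj e) hloop
    · exact absurd e (by simp [label])
    · exact absurd (Option.some.inj e).symm hloop
    · rfl
    · exact absurd e (by simp [label])
    · exact absurd e (by simp [label])
    · exact absurd e (by simp [label])
    · rfl
  · intro k l hkl
    refine hf ?_
    have hk := hmem k
    have hl := hmem l
    simp only at hkl
    revert hkl hk hl
    rcases f k with ⟨a, s⟩
    rcases f l with ⟨b, t⟩
    intro hkl hk hl
    have e := hk.trans hl.symm
    fin_cases s <;> fin_cases t
    · exact congrArg (fun a => (a, (0 : Fin 3))) (Sum.inl.inj hkl)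
    · exact absurd hkl (by simp [dartEdge])
    · exact absurd e (by simp [label])
    · exact absurd hkl (by simp [dartEdge])
    · exact congrArg (fun a => (a, (1 : Fin 3)))
        (eq_of_sym2_eq h (Sum.inr.inj hkl) (Option.some.inj e))
    · exact absurd e (by simp [label])
    · exact absurd e (by simp [label])
    · exact absurd e (by simp [label])
    · exact absurd hk (by simp [label])
  · rw [faceBoundary, π.setOf_faceOf_eq (v := π.corner i) rfl, ← hset, ← hfr, ← Set.range_comp]
    rfl

theorem faceLength_eq (i : Fin (2 * N)) :
    π.faceLength (π.faceOf (i, 1)) = 2 * cycleSize (finRotate (2 * N) * π.perm) i := by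
  rw [faceLength, π.setOf_faceOf_eq (v := π.corner i) rfl, ncard_setOf_label_eq]

theorem faceOf_corner (i : Fin (2 * N)) (f : π.InternalFace)
    (h : π.internalFaceEquiv f = π.corner i) : f.1 = π.faceOf (i, 1) := by
  refine π.faceLabel_injective ?_
  rw [faceLabel_eq_some, h]
  rfl

/-- Different internal faces have different boundaries, since each boundary contains an edge of
the circle and such an edge bounds only one internal face. -/
theorem degreeCount_le_cycleCount (h : π.eulerChar = 2) (d : ℕ) :
    π.degreeCount d ≤ cycleCount π.cubicGraph (2 * d) := by
  classical
  refine Set.ncard_le_ncard_of_injOn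
    (fun v => π.faceBoundary (π.internalFaceEquiv.symm v).1) ?_ ?_ (Set.toFinite _)
  · rintro v rfl
    obtain ⟨i, rfl⟩ := exists_corner v
    have := isCycle_faceBoundary h i
    rw [← degree_embeddedGraph h, ← faceOf_corner i (π.internalFaceEquiv.symm (π.corner i))
      (Equiv.apply_symm_apply _ _)] at this
    exact this
  · rintro u - v - huv
    obtain ⟨i, rfl⟩ := exists_corner u
    obtain ⟨j, rfl⟩ := exists_corner v
    simp only [faceOf_corner i (π.internalFaceEquiv.symm (π.corner i))
      (Equiv.apply_symm_apply _ _), faceOf_corner j (π.internalFaceEquiv.symm (π.corner j))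
      (Equiv.apply_symm_apply _ _), faceBoundary, π.setOf_faceOf_eq (d := (i, 1)) rfl,
      π.setOf_faceOf_eq (d := (j, 1)) rfl] at huv
    have hmem : π.dartEdge ((finRotate (2 * N)).symm i, 0) ∈
        π.dartEdge '' {d | π.label d = some (π.corner i)} :=
      ⟨_, congrArg (fun a => some (π.corner a)) (Equiv.apply_symm_apply _ i), rfl⟩
    rw [huv] at hmem
    obtain ⟨⟨a, t⟩, ha, he⟩ := hmem
    fin_cases t
    · obtain rfl := Sum.inl.inj he
      rw [← Option.some.inj ha]
      exact (congrArg π.corner (Equiv.apply_symm_apply _ i)).symm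
    · exact absurd he (by simp [dartEdge])
    · exact absurd ha (by simp [label])

end Faces

/-! ### The edges of the three-regular graph -/

section Cubic

variable (π : Pairing N)

theorem ncard_edgeSet_cubicGraph : π.cubicGraph.edgeSet.ncard = 3 * N := by
  have h1 : π.cubicGraph.edgeSet =
      Set.range Sum.inl ∪ Sum.inr '' Set.range fun i => s(i, π.perm i) := by
    ext e
    rw [Graph.edgeSet_eq_setOfPred_exists_isLink]
    constructor
    · rintro ⟨x, y, hxy⟩
      rcases e with i | c
      · exact Or.inl ⟨i, rfl⟩
      · exact Or.inr ⟨c, ⟨x, (congrArg (fun a => s(x, a)) hxy.2).trans hxy.1.symm⟩, rfl⟩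
    · rintro (⟨i, rfl⟩ | ⟨_, ⟨i, rfl⟩, rfl⟩)
      · exact ⟨_, _, rfl⟩
      · exact ⟨i, π.perm i, rfl, rfl⟩
  have h2 : (Set.range fun i => s(i, π.perm i)).ncard = N := by
    classical
    let g : Fin (2 * N) → Sym2 (Fin (2 * N)) := fun i => s(i, π.perm i)
    have h3 : Set.range g = ((Finset.univ.image g : Finset _) : Set _) := by simp
    have h4 := Finset.card_eq_sum_card_image g Finset.univ
    rw [Finset.sum_const_nat (m := 2)] at h4
    · change (Set.range g).ncard = N
      rw [h3, Set.ncard_coe_finset]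
      rw [Finset.card_univ, Fintype.card_fin] at h4
      omega
    · intro e he
      obtain ⟨i, -, rfl⟩ := Finset.mem_image.1 he
      refine Eq.trans (congrArg Finset.card ?_) (Finset.card_pair (π.perm_ne i).symm)
      ext j
      simp only [g, Finset.mem_filter, Finset.mem_univ, true_and, Finset.mem_insert,
        Finset.mem_singleton, Sym2.eq_iff]
      constructor
      · rintro (⟨h, -⟩ | ⟨h, -⟩)
        · exact Or.inl h
        · exact Or.inr h
      · rintro (rfl | rfl)
        · exact Or.inl ⟨rfl, rfl⟩
        · exact Or.inr ⟨rfl, π.perm_perm i⟩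
  rw [h1, Set.ncard_union_eq _ (Set.toFinite _) (Set.toFinite _),
    Set.ncard_range_of_injective Sum.inl_injective, Set.ncard_image_of_injective _ Sum.inr_injective,
    h2, Nat.card_fin]
  · ring
  · rw [Set.disjoint_left]
    rintro _ ⟨a, rfl⟩ ⟨b, -, h⟩
    exact absurd h (by simp)

theorem degree_cubicGraph (i : Fin (2 * N)) : degree π.cubicGraph i = 3 := by
  have h1 : π.cubicGraph.loopSet i = ∅ := by
    refine Set.eq_empty_of_forall_notMem ?_
    rintro (j | c) h
    · have h' : s(j, finRotate (2 * N) j) = s(i, i) := h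
      rw [Sym2.eq_iff] at h'
      refine finRotate_ne j ?_
      rcases h' with ⟨rfl, h⟩ | ⟨rfl, h⟩ <;> exact h
    · exact π.perm_ne i h.2
  have h2 : π.cubicGraph.incidenceSet i =
      {Sum.inl i, Sum.inl ((finRotate (2 * N)).symm i), Sum.inr s(i, π.perm i)} := by
    ext e
    simp only [Set.mem_insert_iff, Set.mem_singleton_iff]
    constructor
    · rintro ⟨y, hy⟩
      rcases e with j | c
      · have h' : s(j, finRotate (2 * N) j) = s(i, y) := hy
        rw [Sym2.eq_iff] at h'
        rcases h' with ⟨rfl, -⟩ | ⟨-, h⟩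
        · exact Or.inl rfl
        · right; left
          rw [← h, Equiv.symm_apply_apply]
      · right; right
        obtain ⟨h, h'⟩ := hy
        rw [h, h']
    · rintro (rfl | rfl | rfl)
      · exact ⟨_, rfl⟩
      · refine ⟨(finRotate (2 * N)).symm i, ?_⟩
        refine Eq.trans ?_ Sym2.eq_swap
        exact congrArg (fun a => s(_, a)) (Equiv.apply_symm_apply _ i)
      · exact ⟨_, rfl, rfl⟩
  have h3 : (finRotate (2 * N)).symm i ≠ i := fun h => finRotate_ne i (by
    conv_lhs => rw [← h]
    rw [Equiv.apply_symm_apply])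
  rw [degree, h1, h2, Set.ncard_empty, add_zero, Set.ncard_eq_three]
  exact ⟨_, _, _, by simpa using h3.symm, by simp, by simp, rfl⟩

end Cubic

end Pairing

/-! ### Expected numbers of vertices of given degree -/

section Expectation

/-- Genus-zero pairings as plane one-face maps. -/
def genusZeroEquiv {N : ℕ} (hN : 0 < N) :
    GenusZeroMap N ≃ {π : Equiv.Perm (Fin (2 * N)) // IsPlane (finRotate (2 * N)) π} where
  toFun X := ⟨X.1.perm, (Pairing.eulerChar_eq_two_iff hN).1 X.2⟩
  invFun π := ⟨⟨π.1, π.2.invol, π.2.ne⟩, (Pairing.eulerChar_eq_two_iff hN).2 π.2⟩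
  left_inv _ := rfl
  right_inv _ := rfl

theorem card_cycleSize_eq (n : ℕ) (i : Fin (2 * (n + 1))) (k : ℕ) :
    Nat.card {X : GenusZeroMap (n + 1) //
      cycleSize (finRotate (2 * (n + 1)) * X.1.perm) i = k} = planeCount n k := by
  rw [← rootCount_eq_planeCount (Pairing.numCycles_finRotate_two_mul n.succ_pos)
    (Nat.card_fin _) i k, rootCount]
  refine Nat.card_congr (((genusZeroEquiv n.succ_pos).subtypeEquiv fun X => ?_).trans
    (Equiv.subtypeSubtypeEquivSubtypeInter _
      fun π => cycleSize (finRotate (2 * (n + 1)) * π) i = k))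
  exact Iff.rfl

/-- There are `planeCount (n + 1) 1`, a Catalan number, genus-zero maps with `n + 1` edges. -/
theorem card_genusZeroMap (n : ℕ) :
    Fintype.card (GenusZeroMap (n + 1)) = planeCount (n + 1) 1 := by
  classical
  let i₀ : Fin (2 * (n + 1)) := ⟨0, by omega⟩
  rw [← sum_planeCount, ← Finset.card_univ,
    Finset.card_eq_sum_card_fiberwise
      (f := fun X : GenusZeroMap (n + 1) => cycleSize (finRotate (2 * (n + 1)) * X.1.perm) i₀)
      (t := Finset.range (2 * n + 3))]
  · refine Finset.sum_congr rfl fun k _ => ?_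
    rw [← card_cycleSize_eq n i₀ k, Nat.card_eq_fintype_card, Fintype.card_subtype]
  · intro X _
    have := cycleSize_le_card (finRotate (2 * (n + 1)) * X.1.perm) i₀
    rw [Nat.card_fin] at this
    exact Finset.mem_coe.2 (Finset.mem_range.2 (Nat.lt_of_le_of_lt this (by omega)))

theorem mul_degreeCount {N : ℕ} (X : GenusZeroMap N) (k : ℕ) :
    k * X.1.degreeCount k = {i | cycleSize (finRotate (2 * N) * X.1.perm) i = k}.ncard :=
  mul_ncard_cycles (finRotate (2 * N) * X.1.perm) (fun v => degree X.1.embeddedGraph v)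
    (fun i => Pairing.degree_embeddedGraph X.2 i) k

/-- By rotational symmetry all corners are equally likely to have a vertex of degree `k`. -/
theorem mul_sum_degreeCount (n k : ℕ) :
    k * ∑ X : GenusZeroMap (n + 1), X.1.degreeCount k = 2 * (n + 1) * planeCount n k := by
  classical
  calc k * ∑ X : GenusZeroMap (n + 1), X.1.degreeCount k
      = ∑ X : GenusZeroMap (n + 1), ∑ i : Fin (2 * (n + 1)),
          if cycleSize (finRotate (2 * (n + 1)) * X.1.perm) i = k then 1 else 0 := by
        rw [Finset.mul_sum]
        refine Finset.sum_congr rfl fun X _ => ?_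
        rw [mul_degreeCount, ← Finset.card_filter, ← Set.ncard_coe_finset]
        simp
    _ = ∑ i : Fin (2 * (n + 1)), planeCount n k := by
        rw [Finset.sum_comm]
        refine Finset.sum_congr rfl fun i _ => ?_
        rw [← card_cycleSize_eq n i k, Nat.card_eq_fintype_card, Fintype.card_subtype,
          Finset.card_filter]
    _ = 2 * (n + 1) * planeCount n k := by simp

theorem tendsto_expect_degreeCount {k : ℕ} (hk : 1 ≤ k) :
    Tendsto (fun N : ℕ => expect (fun X : GenusZeroMap N => (X.1.degreeCount k : ℝ)) / N)
      atTop (𝓝 (1 / 2 ^ k)) := by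
  rw [← tendsto_add_atTop_iff_nat 1]
  have hk0 : (k : ℝ) ≠ 0 := by positivity
  have h : ∀ n : ℕ, expect (fun X : GenusZeroMap (n + 1) => (X.1.degreeCount k : ℝ)) /
      ((n + 1 : ℕ) : ℝ) = 2 / k * ((planeCount n k : ℝ) / planeCount (n + 1) 1) := by
    intro n
    have h1 : (k : ℝ) * ∑ X : GenusZeroMap (n + 1), (X.1.degreeCount k : ℝ) =
        2 * (n + 1) * planeCount n k := by exact_mod_cast mul_sum_degreeCount n k
    have h2 : (planeCount (n + 1) 1 : ℝ) ≠ 0 := by exact_mod_cast (planeCount_one_pos _).ne'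
    have h3 : ((n : ℝ) + 1) ≠ 0 := by positivity
    rw [expect, card_genusZeroMap]
    push_cast
    field_simp
    linarith
  simp_rw [h]
  convert (tendsto_planeCount_div k).const_mul (2 / (k : ℝ)) using 2
  field_simp
  ring

theorem expect_mono {α : Type*} [Fintype α] {f g : α → ℝ} (h : ∀ a, f a ≤ g a) :
    expect f ≤ expect g :=
  div_le_div_of_nonneg_right (Finset.sum_le_sum fun a _ => h a) (Nat.cast_nonneg _)

theorem eventually_le_expect_cycleCount {k : ℕ} (hk : 1 ≤ k) {ε : ℝ} (hε : 0 < ε) :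
    ∀ᶠ N : ℕ in atTop, (1 - ε) * (N / 2 ^ k) ≤
      expect (fun X : GenusZeroMap N => (cycleCount X.graph (2 * k) : ℝ)) := by
  have h1 : (1 - ε) * (1 / 2 ^ k) < 1 / (2 : ℝ) ^ k := by
    have : (0 : ℝ) < 1 / 2 ^ k := by positivity
    nlinarith
  filter_upwards [(tendsto_expect_degreeCount hk).eventually_const_lt h1,
    eventually_gt_atTop 0] with N hN hN0
  have hN0' : (0 : ℝ) < N := by exact_mod_cast hN0
  rw [lt_div_iff₀ hN0'] at hN
  calc (1 - ε) * (N / 2 ^ k) = (1 - ε) * (1 / 2 ^ k) * N := by ring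
    _ ≤ _ := hN.le
    _ ≤ _ := expect_mono fun X => by exact_mod_cast Pairing.degreeCount_le_cycleCount X.2 k

end Expectation

/-! ### Sets of positive probability -/

section Probability

/-- Markov's inequality for the complementary event, for a function with values at most `1`. -/
theorem expect_sub_le_ncard_div {α : Type*} [Fintype α] {f : α → ℝ} (hf : ∀ a, f a ≤ 1) {δ : ℝ}
    (hδ : 0 ≤ δ) : expect f - δ ≤ ({a | δ ≤ f a}.ncard : ℝ) / Fintype.card α := by
  classical
  rcases Nat.eq_zero_or_pos (Fintype.card α) with h0 | h0
  · simp [expect, h0, hδ]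
  · have h0' : (0 : ℝ) < Fintype.card α := by exact_mod_cast h0
    have h1 : ∑ a, f a ≤ ∑ a, (δ + if δ ≤ f a then 1 else 0) :=
      Finset.sum_le_sum fun a _ => by
        split_ifs with h
        · linarith [hf a]
        · linarith
    have h2 : ({a | δ ≤ f a}.ncard : ℝ) = ∑ a, if δ ≤ f a then 1 else 0 := by
      rw [Finset.sum_boole, ← Set.ncard_coe_finset]
      simp
    rw [Finset.sum_add_distrib, ← h2, Finset.sum_const, Finset.card_univ, nsmul_eq_mul] at h1
    rw [expect, sub_le_iff_le_add, div_add' _ _ _ h0'.ne']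
    gcongr
    linarith

theorem degreeCount_le {N : ℕ} (X : GenusZeroMap N) (k : ℕ) : X.1.degreeCount k ≤ 2 * N := by
  have h1 : X.1.degreeCount k ≤ Nat.card X.1.MapVertex := Set.ncard_le_card _
  have h2 := X.2
  have h3 := Pairing.pos_of_eulerChar X.2
  rw [Pairing.eulerChar] at h2
  omega

/-- Every cycle is the edge set of a closed walk. -/
theorem cycleCount_le_closedWalkCount {V E : Type*} [Finite V] [Finite E] (G : Graph V E) (r : ℕ) :
    cycleCount G r ≤ closedWalkCount G r := by
  have h : {F | IsCycle G r F} ⊆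
      (fun p : (Fin r → V) × (Fin r → E) => Set.range p.2) '' {p | IsClosedWalk G r p.1 p.2} := by
    rintro _ ⟨-, v, e, hw, -, -, rfl⟩
    exact ⟨(v, e), hw, rfl⟩
  exact (Set.ncard_le_ncard h (Set.toFinite _)).trans (Set.ncard_image_le (Set.toFinite _))

/-- The maps with at least `2 N δ` vertices of degree `k`. -/
def manyVertices (k : ℕ) (δ : ℝ) (N : ℕ) : Set (GenusZeroMap N) :=
  {X | max δ 0 ≤ (X.1.degreeCount k : ℝ) / (2 * N)}

/-- The expected number of vertices of degree `k` per side tends to `1 / 2 ^ (k + 1)`, and this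
number is at most `1`, so that it exceeds `δ` with probability bounded away from zero. -/
theorem exists_le_ncard_manyVertices {k : ℕ} (hk : 1 ≤ k) {δ : ℝ} (hδ : δ < 1 / 2 ^ (k + 1)) :
    ∃ ε : ℝ, 0 < ε ∧ ∀ᶠ N : ℕ in atTop,
      ε ≤ ((manyVertices k δ N).ncard : ℝ) / Fintype.card (GenusZeroMap N) := by
  have hδ' : max δ 0 < 1 / 2 ^ (k + 1) := max_lt hδ (by positivity)
  refine ⟨(1 / 2 ^ (k + 1) - max δ 0) / 2, by linarith, ?_⟩
  have hlim : Tendsto (fun N : ℕ =>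
      expect (fun X : GenusZeroMap N => (X.1.degreeCount k : ℝ) / (2 * N)))
      atTop (𝓝 (1 / 2 ^ (k + 1))) := by
    convert (tendsto_expect_degreeCount hk).div_const 2 using 2
    · rename_i N
      rw [expect, expect, ← Finset.sum_div]
      ring
    · rw [pow_succ]
      field_simp
  have hlt : (1 / 2 ^ (k + 1) + max δ 0) / 2 < 1 / (2 : ℝ) ^ (k + 1) := by linarith
  filter_upwards [hlim.eventually_const_lt hlt] with N hN
  have h1 := expect_sub_le_ncard_div
    (f := fun X : GenusZeroMap N => (X.1.degreeCount k : ℝ) / (2 * N)) (fun X => by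
      refine div_le_one_of_le₀ ?_ (by positivity)
      exact_mod_cast degreeCount_le X k) (le_max_right δ 0)
  refine le_trans ?_ h1
  linarith

theorem le_cycleCount_of_mem_manyVertices {k : ℕ} {δ : ℝ} {N : ℕ} {X : GenusZeroMap N}
    (hX : X ∈ manyVertices k δ N) : δ ≤ (cycleCount X.graph (2 * k) : ℝ) / (2 * N) := by
  refine (le_max_left δ 0).trans (le_trans hX ?_)
  gcongr
  exact Pairing.degreeCount_le_cycleCount X.2 k

theorem cycleCount_div_le {N : ℕ} (X : GenusZeroMap N) (r : ℕ) :
    (cycleCount X.graph r : ℝ) / (2 * N) ≤ (closedWalkCount X.graph r : ℝ) / (2 * N) := by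
  gcongr
  exact cycleCount_le_closedWalkCount _ _

end Probability

/-! ### Permutation matrices -/

section PermMatrix

theorem trace_mul_nonneg {V : Type*} [Fintype V] {A B : Matrix V V ℝ}
    (hA : ∀ i j, 0 ≤ A i j) (hB : ∀ i j, 0 ≤ B i j) :
    0 ≤ (A * B).trace :=
  Finset.sum_nonneg fun i _ => Finset.sum_nonneg fun j _ => mul_nonneg (hA i j) (hB j i)

variable {V : Type*} [DecidableEq V]

theorem permMatrix_apply (σ : Equiv.Perm V) (i j : V) :
    σ.permMatrix ℝ i j = if σ i = j then 1 else 0 := by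
  simp [PEquiv.toMatrix_apply, Equiv.toPEquiv_apply]

theorem permMatrix_injective : Function.Injective fun σ : Equiv.Perm V => σ.permMatrix ℝ := by
  intro σ τ h
  ext i
  have := congrFun (congrFun h i) (σ i)
  simp only [permMatrix_apply, if_true] at this
  by_contra hne
  rw [if_neg (Ne.symm hne)] at this
  exact one_ne_zero this

theorem permMatrix_nonneg (σ : Equiv.Perm V) (i j : V) : 0 ≤ σ.permMatrix ℝ i j := by
  rw [permMatrix_apply]
  split_ifs <;> norm_num

variable [Fintype V]

theorem trace_permMatrix_eq_card (σ : Equiv.Perm V) :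
    (σ.permMatrix ℝ).trace = (Finset.univ.filter fun x => σ x = x).card := by
  rw [Matrix.trace, Finset.card_filter, Nat.cast_sum]
  exact Finset.sum_congr rfl fun i _ => by simp

theorem trace_permMatrix_add_inv_sq (σ : Equiv.Perm V) :
    2 * Fintype.card V + 2 * ((Finset.univ.filter fun x => σ (σ x) = x).card : ℝ) ≤
      ((σ.permMatrix ℝ + σ⁻¹.permMatrix ℝ) * (σ.permMatrix ℝ + σ⁻¹.permMatrix ℝ)).trace := by
  have h : (Finset.univ.filter fun x => (σ⁻¹ * σ⁻¹ : Equiv.Perm V) x = x) =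
      Finset.univ.filter fun x => σ (σ x) = x := by
    ext x
    simp only [Finset.mem_filter, Finset.mem_univ, true_and, Equiv.Perm.mul_apply,
      Equiv.Perm.inv_eq_iff_eq]
    exact eq_comm
  have h1 : ((σ * σ).permMatrix ℝ).trace = (Finset.univ.filter fun x => σ (σ x) = x).card :=
    trace_permMatrix_eq_card (σ * σ)
  have h2 : ((σ⁻¹ * σ⁻¹).permMatrix ℝ).trace = (Finset.univ.filter fun x => σ (σ x) = x).card := by
    rw [trace_permMatrix_eq_card, h]
  rw [mul_add, add_mul, add_mul, ← Matrix.permMatrix_mul, ← Matrix.permMatrix_mul,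
    ← Matrix.permMatrix_mul, ← Matrix.permMatrix_mul, mul_inv_cancel, inv_mul_cancel,
    Matrix.permMatrix_one, Matrix.trace_add, Matrix.trace_add, Matrix.trace_add, Matrix.trace_one,
    h1, h2]
  linarith

/-- Closed walks of length four in the graph with the adjacency matrix `r + r⁻¹ + m`: the walks
that exist in the three-regular tree account for `15` walks per vertex, and every fixed point of
`(r m) ^ 2` adds at least another two. -/
theorem le_trace_pow_four (r m : Equiv.Perm V) (hm : m * m = 1) :
    15 * (Fintype.card V : ℝ) +
        2 * ((Finset.univ.filter fun x => (r * m) ((r * m) x) = x).card : ℝ) ≤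
      ((r.permMatrix ℝ + r⁻¹.permMatrix ℝ + m.permMatrix ℝ) ^ 4).trace := by
  have hm' : m⁻¹ = m := inv_eq_of_mul_eq_one_left hm
  let H : Equiv.Perm V → Matrix V V ℝ := fun σ => σ.permMatrix ℝ + σ⁻¹.permMatrix ℝ
  have hH : ∀ σ i j, 0 ≤ H σ i j := fun σ i j =>
    add_nonneg (permMatrix_nonneg _ i j) (permMatrix_nonneg _ i j)
  have hH1 : ∀ σ, 0 ≤ (H σ).trace := fun σ => Finset.sum_nonneg fun i _ => hH σ i i
  have hcross : ∀ σ τ, 0 ≤ (H σ * H τ).trace := fun σ τ => trace_mul_nonneg (hH σ) (hH τ)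
  have hsq : ∀ σ, 2 * (Fintype.card V : ℝ) ≤ (H σ * H σ).trace := fun σ => by
    refine le_trans ?_ (trace_permMatrix_add_inv_sq σ)
    have : (0 : ℝ) ≤ ((Finset.univ.filter fun x => σ (σ x) = x).card : ℝ) := Nat.cast_nonneg _
    linarith
  have hA : (r.permMatrix ℝ + r⁻¹.permMatrix ℝ + m.permMatrix ℝ) ^ 2 =
      3 • 1 + (H (r * r) + H (m * r) + H (r * m)) := by
    have e1 : r.permMatrix ℝ * r.permMatrix ℝ = (r * r).permMatrix ℝ :=
      (Matrix.permMatrix_mul r r).symm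
    have e2 : r.permMatrix ℝ * r⁻¹.permMatrix ℝ = 1 := by
      rw [← Matrix.permMatrix_mul, inv_mul_cancel, Matrix.permMatrix_one]
    have e3 : r⁻¹.permMatrix ℝ * r.permMatrix ℝ = 1 := by
      rw [← Matrix.permMatrix_mul, mul_inv_cancel, Matrix.permMatrix_one]
    have e4 : m.permMatrix ℝ * m.permMatrix ℝ = 1 := by
      rw [← Matrix.permMatrix_mul, hm, Matrix.permMatrix_one]
    simp only [H, mul_inv_rev, hm', pow_two, mul_add, add_mul, e2, e3, e4, Matrix.permMatrix_mul]
    abel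
  have h4 : (r.permMatrix ℝ + r⁻¹.permMatrix ℝ + m.permMatrix ℝ) ^ 4 =
      (3 • 1 + (H (r * r) + H (m * r) + H (r * m))) *
        (3 • 1 + (H (r * r) + H (m * r) + H (r * m))) := by
    rw [← hA, ← pow_add]
  have h5 := trace_permMatrix_add_inv_sq (r * m)
  change _ ≤ (H (r * m) * H (r * m)).trace at h5
  rw [h4]
  have hexp : ∀ A B C : Matrix V V ℝ, ((3 • 1 + (A + B + C)) * (3 • 1 + (A + B + C))).trace =
      9 * (Fintype.card V : ℝ) + 6 * (A.trace + B.trace + C.trace) +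
        ((A * A).trace + (B * B).trace + (C * C).trace +
          2 * ((A * B).trace + (A * C).trace + (B * C).trace)) := by
    intro A B C
    have e1 : (3 : ℕ) • (1 : Matrix V V ℝ) = (3 : ℝ) • 1 := by
      rw [← Nat.cast_smul_eq_nsmul ℝ]
      norm_num
    rw [e1]
    simp only [mul_add, add_mul, smul_mul_assoc, mul_smul_comm, one_mul, mul_one,
      Matrix.trace_add, Matrix.trace_smul, Matrix.trace_one, smul_eq_mul, Matrix.trace_mul_comm B A,
      Matrix.trace_mul_comm C A, Matrix.trace_mul_comm C B]
    ring
  rw [hexp]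
  have h6 := hsq (r * r)
  have h7 := hsq (m * r)
  have h8 := hcross (r * r) (m * r)
  have h9 := hcross (r * r) (r * m)
  have h10 := hcross (m * r) (r * m)
  have h11 := hH1 (r * r)
  have h12 := hH1 (m * r)
  have h13 := hH1 (r * m)
  linarith

end PermMatrix

/-! ### The adjacency matrices -/

namespace Pairing

variable {N : ℕ}

theorem ncard_setOf_eq_and {α : Type*} (a : α) (p : Prop) [Decidable p] :
    {e | e = a ∧ p}.ncard = if p then 1 else 0 := by
  split_ifs with h <;> simp [h]

theorem adjMatrix_cubicGraph (π : Pairing N) :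
    adjMatrix π.cubicGraph = (finRotate (2 * N)).permMatrix ℝ +
      (finRotate (2 * N))⁻¹.permMatrix ℝ + π.perm.permMatrix ℝ := by
  ext i j
  have h : {e | π.cubicGraph.IsLink e i j} =
      {e | e = Sum.inl i ∧ finRotate (2 * N) i = j} ∪
        {e | e = Sum.inl j ∧ finRotate (2 * N) j = i} ∪
        {e | e = Sum.inr s(i, j) ∧ π.perm i = j} := by
    ext e
    simp only [Set.mem_union, Set.mem_ofPred_eq]
    rcases e with a | c
    · change s(a, finRotate (2 * N) a) = s(i, j) ↔ _
      rw [Sym2.eq_iff, Sum.inl.injEq, Sum.inl.injEq]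
      simp only [reduceCtorEq, false_and, or_false]
      constructor
      · rintro (⟨rfl, h⟩ | ⟨rfl, h⟩)
        · exact Or.inl ⟨rfl, h⟩
        · exact Or.inr ⟨rfl, h⟩
      · rintro (⟨rfl, h⟩ | ⟨rfl, h⟩)
        · exact Or.inl ⟨rfl, h⟩
        · exact Or.inr ⟨rfl, h⟩
    · change (c = s(i, j) ∧ π.perm i = j) ↔ _
      simp
  rw [adjMatrix, h, Set.ncard_union_eq ?_ (Set.toFinite _) (Set.toFinite _),
    Set.ncard_union_eq ?_ (Set.toFinite _) (Set.toFinite _), ncard_setOf_eq_and,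
    ncard_setOf_eq_and, ncard_setOf_eq_and, Matrix.add_apply, Matrix.add_apply, permMatrix_apply,
    permMatrix_apply, permMatrix_apply]
  · push_cast
    simp only [Equiv.Perm.inv_eq_iff_eq, eq_comm (a := i)]
  · rw [Set.disjoint_left]
    rintro e ⟨rfl, h1⟩ ⟨h2, -⟩
    obtain rfl := Sum.inl.inj h2
    exact finRotate_ne _ h1
  · rw [Set.disjoint_left]
    rintro e (⟨rfl, -⟩ | ⟨rfl, -⟩) ⟨h2, -⟩ <;> exact absurd h2 (by simp)

theorem adjMatrix_cubicGraph_injective :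
    Function.Injective fun π : Pairing N => adjMatrix π.cubicGraph := by
  intro π π' h
  simp only [adjMatrix_cubicGraph, add_right_inj] at h
  exact Subtype.ext (permMatrix_injective h)

theorem cycleMatrix_eq (N : ℕ) : cycleMatrix N = (finRotate (2 * N)).permMatrix ℝ +
    (finRotate (2 * N))⁻¹.permMatrix ℝ := by
  ext i j
  rw [Matrix.add_apply, permMatrix_apply, permMatrix_apply, cycleMatrix]
  simp only [Equiv.Perm.inv_eq_iff_eq, eq_comm (a := j)]

/-- The involution that exchanges `2j` and `2j + 1`. -/
def toothpickFun (i : Fin (2 * N)) : Fin (2 * N) :=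
  if h : i.val % 2 = 0 then ⟨i.val + 1, by have := i.isLt; omega⟩
  else ⟨i.val - 1, by have := i.isLt; omega⟩

theorem toothpickFun_eq_iff (i j : Fin (2 * N)) :
    toothpickFun i = j ↔ i ≠ j ∧ i.val / 2 = j.val / 2 := by
  rw [toothpickFun]
  split_ifs with h
  · rw [Fin.ext_iff, ne_eq, Fin.ext_iff]
    simp only
    omega
  · rw [Fin.ext_iff, ne_eq, Fin.ext_iff]
    simp only
    omega

theorem toothpickFun_involutive : Function.Involutive (toothpickFun (N := N)) := by
  intro i
  have h := (toothpickFun_eq_iff i _).1 rfl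
  exact (toothpickFun_eq_iff _ _).2 ⟨h.1.symm, h.2.symm⟩

theorem toothpickFun_ne (i : Fin (2 * N)) : toothpickFun i ≠ i :=
  ((toothpickFun_eq_iff i _).1 rfl).1.symm

/-- The standard pair partition. -/
def toothpick (N : ℕ) : Pairing N :=
  ⟨toothpickFun_involutive.toPerm, toothpickFun_involutive, toothpickFun_ne⟩

theorem toothpickMatrix_eq (N : ℕ) : toothpickMatrix N = (toothpick N).perm.permMatrix ℝ := by
  ext i j
  rw [permMatrix_apply, toothpickMatrix]
  exact if_congr (toothpickFun_eq_iff i j).symm rfl rfl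

theorem conj_toothpickMatrix (σ : Equiv.Perm (Fin (2 * N))) :
    (σ.permMatrix ℝ)ᵀ * toothpickMatrix N * σ.permMatrix ℝ =
      (σ * (toothpick N).perm * σ⁻¹).permMatrix ℝ := by
  rw [toothpickMatrix_eq, Matrix.transpose_permMatrix, Matrix.permMatrix_mul,
    Matrix.permMatrix_mul, mul_assoc]

/-- All pair partitions are conjugate, as they have the same cycle type. -/
theorem cycleType_perm (π : Pairing N) : π.perm.cycleType = Multiset.replicate N 2 := by
  have h2 : ∀ n ∈ π.perm.cycleType, n = 2 := by
    intro n hn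
    have h1 : n ∣ 2 := (Equiv.Perm.dvd_of_mem_cycleType hn).trans
      (orderOf_dvd_of_pow_eq_one (Equiv.ext fun i => by
        rw [pow_two]
        exact π.perm_perm i))
    exact le_antisymm (Nat.le_of_dvd (by norm_num) h1) (Equiv.Perm.two_le_of_mem_cycleType hn)
  rw [Multiset.eq_replicate]
  refine ⟨?_, h2⟩
  have h3 := π.perm.sum_cycleType
  have h4 : π.perm.support = Finset.univ :=
    Finset.eq_univ_of_forall fun i => Equiv.Perm.mem_support.2 (π.perm_ne i)
  rw [Multiset.eq_replicate_card.2 h2, Multiset.sum_replicate, h4, Finset.card_univ,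
    Fintype.card_fin, smul_eq_mul] at h3
  omega

theorem range_adjMatrix_cubicGraph (N : ℕ) :
    Set.range (fun π : Pairing N => adjMatrix π.cubicGraph) =
      {A | ∃ σ : Equiv.Perm (Fin (2 * N)),
        A = cycleMatrix N + (σ.permMatrix ℝ)ᵀ * toothpickMatrix N * σ.permMatrix ℝ} := by
  ext A
  simp only [Set.mem_range, Set.mem_ofPred_eq, conj_toothpickMatrix, adjMatrix_cubicGraph,
    ← cycleMatrix_eq]
  constructor
  · rintro ⟨π, rfl⟩
    obtain ⟨σ, hσ⟩ := isConj_iff.1 (Equiv.Perm.isConj_iff_cycleType_eq.2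
      ((toothpick N).cycleType_perm.trans π.cycleType_perm.symm))
    exact ⟨σ, by rw [hσ]⟩
  · rintro ⟨σ, rfl⟩
    refine ⟨⟨σ * (toothpick N).perm * σ⁻¹, fun i => ?_, fun i hi => ?_⟩, rfl⟩
    · simp [perm_perm]
    · refine (toothpick N).perm_ne (σ⁻¹ i) ?_
      rw [Equiv.Perm.eq_inv_iff_eq]
      exact hi

/-- A genus-zero map has many vertices of degree at most two, and each of their corners yields
closed walks of length four. -/
theorem le_trace_adjMatrix_pow_four {π : Pairing N} (h : π.eulerChar = 2) :
    31 * (N : ℝ) ≤ (adjMatrix π.cubicGraph ^ 4).trace := by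
  have hP := isPlane_of_eulerChar h
  have h1 := le_trace_pow_four (finRotate (2 * N)) π.perm (Equiv.ext π.perm_perm)
  have h2 := three_mul_numCycles_le (finRotate (2 * N) * π.perm)
  have h3 := hP.euler
  rw [Nat.card_fin] at h3
  rw [Fintype.card_fin] at h1 h2
  rw [adjMatrix_cubicGraph]
  refine le_trans ?_ h1
  have h4 : N ≤ 2 * (Finset.univ.filter fun x =>
      (finRotate (2 * N) * π.perm) ((finRotate (2 * N) * π.perm) x) = x).card := by omega
  have h5 : (N : ℝ) ≤ 2 * ((Finset.univ.filter fun x =>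
      (finRotate (2 * N) * π.perm) ((finRotate (2 * N) * π.perm) x) = x).card : ℝ) := by
    exact_mod_cast h4
  rw [Nat.cast_mul, Nat.cast_ofNat]
  linarith

theorem sum_abs_adjMatrix_cubicGraph (π : Pairing N) (i : Fin (2 * N)) :
    ∑ j, |adjMatrix π.cubicGraph i j| = 3 := by
  have h : ∀ j, |adjMatrix π.cubicGraph i j| = adjMatrix π.cubicGraph i j := fun j =>
    abs_of_nonneg (Nat.cast_nonneg _)
  rw [Finset.sum_congr rfl fun j _ => h j]
  simp only [adjMatrix_cubicGraph, Matrix.add_apply, permMatrix_apply, Finset.sum_add_distrib,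
    Finset.sum_ite_eq, Finset.mem_univ, if_true]
  norm_num

end Pairing

/-! ### Eigenvalues -/

section Eigenvalues

variable {n : Type*} [Fintype n] [DecidableEq n] {A : Matrix n n ℝ}

theorem trace_pow_eq_sum_eigenvalues (hA : A.IsHermitian) (k : ℕ) :
    (A ^ k).trace = ∑ i, hA.eigenvalues i ^ k := by
  have h : A ^ k = Unitary.conjStarAlgAut ℝ (Matrix n n ℝ) hA.eigenvectorUnitary
      (Matrix.diagonal fun i => hA.eigenvalues i ^ k) := by
    conv_lhs => rw [hA.spectral_theorem]
    rw [← map_pow, Matrix.diagonal_pow]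
    rfl
  rw [h, Unitary.conjStarAlgAut_apply, Matrix.trace_mul_comm, ← mul_assoc,
    Unitary.coe_star_mul_self, one_mul, Matrix.trace_diagonal]

/-- Gershgorin's theorem for the eigenvalues of a matrix with bounded row sums. -/
theorem abs_eigenvalues_le (hA : A.IsHermitian) {b : ℝ} (h : ∀ i, ∑ j, |A i j| ≤ b) (i : n) :
    |hA.eigenvalues i| ≤ b := by
  have hev : Module.End.HasEigenvalue (Matrix.toLin' A) (hA.eigenvalues i) := by
    refine Module.End.hasEigenvalue_of_hasEigenvector
      (x := (hA.eigenvectorBasis i).ofLp) ⟨?_, fun h0 => ?_⟩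
    · rw [Module.End.mem_eigenspace_iff, Matrix.toLin'_apply, hA.mulVec_eigenvectorBasis]
    · refine hA.eigenvectorBasis.orthonormal.ne_zero i ?_
      ext j
      exact congrFun h0 j
  obtain ⟨k, hk⟩ := eigenvalue_mem_ball hev
  rw [Metric.mem_closedBall, Real.dist_eq] at hk
  have h1 := Finset.add_sum_erase Finset.univ (fun j => |A k j|) (Finset.mem_univ k)
  simp only [Real.norm_eq_abs] at hk
  have h2 := abs_sub_abs_le_abs_sub (hA.eigenvalues i) (A k k)
  linarith [h k]

end Eigenvalues

/-! ### The fourth moment of the McKay density -/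

section McKay

/-- The test function `81 - x ^ 4`, cut off outside `[-3, 3]`. -/
noncomputable def testFun : BoundedContinuousFunction ℝ ℝ :=
  BoundedContinuousFunction.ofNormedAddCommGroup (fun x => max (81 - x ^ 4) 0) (by fun_prop) 81
    fun x => by
      rw [Real.norm_eq_abs, abs_of_nonneg (le_max_right _ _)]
      exact max_le (by nlinarith [sq_nonneg (x ^ 2)]) (by norm_num)

theorem testFun_apply (x : ℝ) : testFun x = max (81 - x ^ 4) 0 := rfl

theorem testFun_of_abs_le {x : ℝ} (hx : |x| ≤ 3) : testFun x = 81 - x ^ 4 := by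
  rw [testFun_apply, max_eq_left]
  have h1 : x ^ 2 ≤ 3 ^ 2 := sq_le_sq.2 (by simpa using hx)
  nlinarith [sq_nonneg x]

/-- An antiderivative of `√(1 - x ^ 2) (1 - 4 x ^ 2)` is `x (1 - x ^ 2) ^ (3 / 2)`, which vanishes
at both ends. -/
theorem integral_sq_mul_sqrt_one_sub_sq :
    ∫ x in (-1 : ℝ)..1, x ^ 2 * √(1 - x ^ 2) = Real.pi / 8 := by
  have hd : ∀ x ∈ Set.Ioo (-1 : ℝ) 1,
      HasDerivAt (fun x : ℝ => x * (1 - x ^ 2) * √(1 - x ^ 2))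
        (√(1 - x ^ 2) - 4 * (x ^ 2 * √(1 - x ^ 2))) x := by
    intro x hx
    have hpos : 0 < 1 - x ^ 2 := by nlinarith [hx.1, hx.2]
    have h1 : HasDerivAt (fun x : ℝ => 1 - x ^ 2) (-(2 * x)) x := by
      simpa using ((hasDerivAt_id x).pow 2).const_sub 1
    refine HasDerivAt.congr_deriv (((hasDerivAt_id x).mul h1).mul (h1.sqrt hpos.ne')) ?_
    have hs : √(1 - x ^ 2) ≠ 0 := (Real.sqrt_pos.2 hpos).ne'
    have hs2 : √(1 - x ^ 2) ^ 2 = 1 - x ^ 2 := Real.sq_sqrt hpos.le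
    simp only [id, Pi.mul_apply]
    field_simp
    rw [hs2]
    ring
  have hc1 : Continuous fun x : ℝ => √(1 - x ^ 2) := by fun_prop
  have hc3 : Continuous fun x : ℝ => 4 * (x ^ 2 * √(1 - x ^ 2)) := by fun_prop
  have h := intervalIntegral.integral_eq_sub_of_hasDerivAt_of_le (by norm_num : (-1 : ℝ) ≤ 1)
    (by fun_prop) hd ((hc1.sub hc3).intervalIntegrable _ _)
  rw [intervalIntegral.integral_sub (hc1.intervalIntegrable _ _)
    (hc3.intervalIntegrable _ _), intervalIntegral.integral_const_mul,
    integral_sqrt_one_sub_sq] at h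
  norm_num at h
  linarith

/-- Up to a constant, `(81 - x ^ 4) * mckayDensity 3 x` is a polynomial times a semicircle
density. -/
theorem testFun_mul_mckayDensity (x : ℝ) :
    testFun x * mckayDensity 3 x =
      3 / (2 * Real.pi) * ((9 + x ^ 2) * √(8 - x ^ 2)) := by
  have h8 : 2 * √(((3 : ℕ) : ℝ) - 1) = √8 := by
    rw [show (8 : ℝ) = 2 ^ 2 * 2 by norm_num, Real.sqrt_mul (by norm_num),
      Real.sqrt_sq (by norm_num)]
    norm_num
  rw [mckayDensity, h8]
  split_ifs with h
  · have hx : x ^ 2 ≤ 8 := by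
      have := sq_le_sq.2 (show |x| ≤ |√8| by rwa [abs_of_nonneg (Real.sqrt_nonneg 8)])
      rwa [Real.sq_sqrt (by norm_num)] at this
    have h3 : |x| ≤ 3 := h.trans (by
      rw [Real.sqrt_le_left (by norm_num)]
      norm_num)
    rw [testFun_of_abs_le h3]
    have h9 : 9 - x ^ 2 ≠ 0 := by
      intro h0
      linarith
    have e1 : 4 * (((3 : ℕ) : ℝ) - 1) - x ^ 2 = 8 - x ^ 2 := by
      norm_num
    have e2 : ((3 : ℕ) : ℝ) ^ 2 - x ^ 2 = 9 - x ^ 2 := by norm_num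
    rw [e1, e2]
    have hpi := Real.pi_ne_zero
    push_cast
    field_simp
    ring
  · have hx : 8 - x ^ 2 ≤ 0 := by
      have := Real.sqrt_lt_sqrt (by norm_num) (show (8 : ℝ) < x ^ 2 by
        rw [← Real.sqrt_sq_eq_abs] at h
        exact (Real.sqrt_lt_sqrt_iff (by norm_num)).1 (not_le.1 h))
      nlinarith [(Real.sqrt_lt_sqrt_iff (by norm_num)).1 this]
    rw [Real.sqrt_eq_zero_of_nonpos hx]
    ring

theorem integral_testFun_mul_mckayDensity : ∫ x, testFun x * mckayDensity 3 x = 66 := by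
  simp only [testFun_mul_mckayDensity]
  rw [integral_const_mul]
  have hs8 : (0 : ℝ) < √8 := Real.sqrt_pos.2 (by norm_num)
  have hsq8 : √(8 : ℝ) ^ 2 = 8 := Real.sq_sqrt (by norm_num)
  have hsupp : Function.support (fun x : ℝ => (9 + x ^ 2) * √(8 - x ^ 2)) ⊆
      Set.Ioc (√8 * (-1)) (√8 * 1) := by
    intro x hx
    have hx' : 0 < 8 - x ^ 2 := by
      by_contra h0
      exact hx (by simp [Real.sqrt_eq_zero_of_nonpos (not_lt.1 h0)])
    have : |x| < √8 := Real.lt_sqrt_of_sq_lt (by rw [sq_abs]; linarith)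
    rw [mul_one, mul_neg_one]
    exact ⟨(abs_lt.1 this).1, (abs_lt.1 this).2.le⟩
  rw [← intervalIntegral.integral_eq_integral_of_support_subset hsupp,
    ← intervalIntegral.mul_integral_comp_mul_left (f := fun x => (9 + x ^ 2) * √(8 - x ^ 2))]
  have hsub : ∀ x : ℝ, (9 + (√8 * x) ^ 2) * √(8 - (√8 * x) ^ 2) =
      √8 * (9 * √(1 - x ^ 2) + 8 * (x ^ 2 * √(1 - x ^ 2))) := by
    intro x
    have e : 8 - (√8 * x) ^ 2 = 8 * (1 - x ^ 2) := by
      rw [mul_pow, hsq8]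
      ring
    rw [e, Real.sqrt_mul (by norm_num), mul_pow, hsq8]
    ring
  have hc1 : Continuous fun x : ℝ => 9 * √(1 - x ^ 2) := by fun_prop
  have hc2 : Continuous fun x : ℝ => 8 * (x ^ 2 * √(1 - x ^ 2)) := by fun_prop
  simp only [hsub]
  rw [intervalIntegral.integral_const_mul,
    intervalIntegral.integral_add (hc1.intervalIntegrable _ _)
      (hc2.intervalIntegrable _ _), intervalIntegral.integral_const_mul,
    intervalIntegral.integral_const_mul, integral_sqrt_one_sub_sq, integral_sq_mul_sqrt_one_sub_sq]
  have hpi := Real.pi_ne_zero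
  have : √8 * (√8 * (9 * (Real.pi / 2) + 8 * (Real.pi / 8))) = 44 * Real.pi := by
    rw [← mul_assoc, ← pow_two, hsq8]
    ring
  rw [this]
  field_simp
  norm_num

end McKay

/-! ### The limiting eigenvalue density -/

section Limits

/-- The average of the test function over the eigenvalues of a genus-zero graph stays below its
integral `66` against the McKay density. -/
theorem spectralAverage_testFun_le {N : ℕ} (X : GenusZeroMap N) :
    spectralAverage X.graph testFun ≤ 131 / 2 := by
  have hN : (0 : ℝ) < N := by exact_mod_cast Pairing.pos_of_eulerChar X.2
  have h1 : ∀ i, testFun ((adjMatrix_isHermitian X.graph).eigenvalues i) =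
      81 - (adjMatrix_isHermitian X.graph).eigenvalues i ^ 4 := fun i =>
    testFun_of_abs_le (abs_eigenvalues_le _
      (fun i => (Pairing.sum_abs_adjMatrix_cubicGraph X.1 i).le) i)
  have h2 : 31 * (N : ℝ) ≤ (adjMatrix X.graph ^ 4).trace :=
    Pairing.le_trace_adjMatrix_pow_four X.2
  rw [trace_pow_eq_sum_eigenvalues (adjMatrix_isHermitian X.graph)] at h2
  rw [spectralAverage, Finset.sum_congr rfl fun i _ => h1 i, Finset.sum_sub_distrib,
    Finset.sum_const, Finset.card_univ, Fintype.card_fin, nsmul_eq_mul, Nat.cast_mul,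
    Nat.cast_ofNat, div_le_iff₀ (by positivity)]
  linarith

theorem not_hasLimitingDensity {μ : ℕ → (ℝ → ℝ) → ℝ}
    (h : ∀ᶠ j in atTop, μ j testFun ≤ 131 / 2) : ¬ HasLimitingDensity μ (mckayDensity 3) := by
  intro hμ
  have h1 := le_of_tendsto (hμ testFun) h
  rw [integral_testFun_mul_mckayDensity] at h1
  norm_num at h1

theorem expect_le {α : Type*} [Fintype α] {f : α → ℝ} {m : ℝ} (hm : 0 ≤ m) (hf : ∀ a, f a ≤ m) :
    expect f ≤ m := by
  refine div_le_of_le_mul₀ (Nat.cast_nonneg _) hm ?_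
  have := Finset.sum_le_card_nsmul Finset.univ f m fun a _ => hf a
  rw [Finset.card_univ, nsmul_eq_mul] at this
  linarith

end Limits

end OneFace

theorem mainTheorem2 :
    -- the graphs of the pair partitions are the graphs with adjacency matrix `C + Pᵀ T P`,
    -- and distinct pair partitions have distinct graphs
    (∀ N : ℕ,
      Set.range (fun π : Pairing N => adjMatrix π.cubicGraph) =
        {A | ∃ σ : Equiv.Perm (Fin (2 * N)),
          A = cycleMatrix N + (σ.permMatrix ℝ)ᵀ * toothpickMatrix N * σ.permMatrix ℝ} ∧
      Function.Injective (fun π : Pairing N => adjMatrix π.cubicGraph)) ∧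
    -- genus zero: plane trees, planar three-regular graphs, faces, vertices and cycles
    (∀ (N : ℕ) (X : GenusZeroMap N),
      IsTree X.1.embeddedGraph ∧
      (∀ v, degree X.graph v = 3) ∧
      ((2 * N : ℤ) - X.graph.edgeSet.ncard + Nat.card X.1.Face = 2) ∧
      (∃ Φ : X.1.InternalFace ≃ X.1.MapVertex,
        (∀ (i : Fin (2 * N)) (f : X.1.InternalFace), X.1.faceOf (i, 0) = f.1 →
          Φ f = X.1.corner (finRotate (2 * N) i)) ∧
        (∀ f, X.1.faceLength f.1 = 2 * degree X.1.embeddedGraph (Φ f)) ∧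
        (∀ f, IsCycle X.graph (2 * degree X.1.embeddedGraph (Φ f)) (X.1.faceBoundary f.1))) ∧
      (∀ d, X.1.degreeCount d ≤ cycleCount X.graph (2 * d))) ∧
    -- the expected number of vertices of degree `k` is asymptotically `N / 2 ^ k`
    (∀ k : ℕ, 1 ≤ k →
      Tendsto (fun N : ℕ => expect (fun X : GenusZeroMap N => (X.1.degreeCount k : ℝ)) / N)
        atTop (𝓝 (1 / 2 ^ k))) ∧
    -- the expected number of `2k`-cycles is asymptotically at least `N / 2 ^ k`
    (∀ k : ℕ, 1 ≤ k → ∀ ε : ℝ, 0 < ε → ∀ᶠ N : ℕ in atTop,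
      (1 - ε) * (N / 2 ^ k) ≤
        expect (fun X : GenusZeroMap N => (cycleCount X.graph (2 * k) : ℝ))) ∧
    -- the numbers of `2k`-cycles and of closed walks of length `2k`, per vertex, are bounded away
    -- from zero on sets of graphs whose probability is bounded away from zero
    (∀ k : ℕ, 1 ≤ k → ∀ δ : ℝ, δ < 1 / 2 ^ (k + 1) →
      ∃ (ε : ℝ) (S : ∀ N, Set (GenusZeroMap N)), 0 < ε ∧
        (∀ᶠ N : ℕ in atTop, ε ≤ ((S N).ncard : ℝ) / Fintype.card (GenusZeroMap N)) ∧
        ∀ N, ∀ X ∈ S N,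
          δ ≤ (cycleCount X.graph (2 * k) : ℝ) / (2 * N) ∧
          (cycleCount X.graph (2 * k) : ℝ) / (2 * N) ≤
            (closedWalkCount X.graph (2 * k) : ℝ) / (2 * N)) ∧
    -- McKay's hypothesis fails for all sequences of graphs in such sets
    (∃ (ε : ℝ) (S : ∀ N, Set (GenusZeroMap N)), 0 < ε ∧
      (∀ᶠ N : ℕ in atTop, ε ≤ ((S N).ncard : ℝ) / Fintype.card (GenusZeroMap N)) ∧
      ∀ (n : ℕ → ℕ) (X : ∀ j, GenusZeroMap (n j)), Tendsto n atTop atTop →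
        (∀ j, X j ∈ S (n j)) →
          (¬ ∀ r : ℕ, 3 ≤ r →
            Tendsto (fun j => (cycleCount (X j).graph r : ℝ) / (2 * n j)) atTop (𝓝 0)) ∧
          (¬ ∀ r : ℕ, 3 ≤ r →
            Tendsto (fun j => (closedWalkCount (X j).graph r : ℝ) / (2 * n j)) atTop (𝓝 0))) ∧
    -- the limiting eigenvalue density is not the McKay density: neither for the expected
    -- eigenvalue distribution of a random graph, nor along any sequence of graphs
    (∀ n : ℕ → ℕ, Tendsto n atTop atTop →
      (¬ HasLimitingDensity
        (fun j g => expect (fun X : GenusZeroMap (n j) => spectralAverage X.graph g))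
        (mckayDensity 3)) ∧
      ∀ X : ∀ j, GenusZeroMap (n j),
        ¬ HasLimitingDensity (fun j => spectralAverage (X j).graph) (mckayDensity 3)) := by
  refine ⟨fun N => ⟨Pairing.range_adjMatrix_cubicGraph N, Pairing.adjMatrix_cubicGraph_injective⟩,
    fun N X => ?_, fun k hk => tendsto_expect_degreeCount hk,
    fun k hk ε hε => eventually_le_expect_cycleCount hk hε, fun k hk δ hδ => ?_, ?_,
    fun n _ => ⟨not_hasLimitingDensity (.of_forall fun j =>
      expect_le (by norm_num) fun X => spectralAverage_testFun_le X),
      fun X => not_hasLimitingDensity (.of_forall fun j => spectralAverage_testFun_le (X j))⟩⟩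
  · refine ⟨Pairing.isTree_embeddedGraph X.2, Pairing.degree_cubicGraph X.1, ?_,
      ⟨X.1.internalFaceEquiv, fun i f hf => ?_, fun f => ?_, fun f => ?_⟩,
      Pairing.degreeCount_le_cycleCount X.2⟩
    · have h1 : X.graph.edgeSet.ncard = 3 * N := Pairing.ncard_edgeSet_cubicGraph X.1
      have h2 := X.1.card_face (Pairing.pos_of_eulerChar X.2)
      have h3 := X.2
      rw [Pairing.eulerChar] at h3
      rw [h1, h2]
      push_cast
      linarith
    · have h1 := X.1.faceLabel_eq_some f
      rw [← hf] at h1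
      exact (Option.some.inj h1).symm
    · obtain ⟨i, hi⟩ := Pairing.exists_corner (X.1.internalFaceEquiv f)
      rw [← hi, Pairing.degree_embeddedGraph X.2, Pairing.faceOf_corner i f hi.symm,
        Pairing.faceLength_eq]
    · obtain ⟨i, hi⟩ := Pairing.exists_corner (X.1.internalFaceEquiv f)
      rw [← hi, Pairing.degree_embeddedGraph X.2, Pairing.faceOf_corner i f hi.symm]
      exact Pairing.isCycle_faceBoundary X.2 i
  · obtain ⟨ε, hε, hS⟩ := exists_le_ncard_manyVertices hk hδ
    exact ⟨ε, manyVertices k δ, hε, hS, fun N X hX =>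
      ⟨le_cycleCount_of_mem_manyVertices hX, cycleCount_div_le X (2 * k)⟩⟩
  · -- cycles of length four already violate the hypothesis
    obtain ⟨ε, hε, hS⟩ := exists_le_ncard_manyVertices (k := 2) (δ := 1 / 16) (by norm_num)
      (by norm_num)
    have h1 : ∀ (N : ℕ), ∀ X ∈ manyVertices 2 (1 / 16) N,
        (1 / 16 : ℝ) ≤ (cycleCount X.graph 4 : ℝ) / (2 * N) := fun N X hX =>
      le_cycleCount_of_mem_manyVertices (k := 2) hX
    refine ⟨ε, manyVertices 2 (1 / 16), hε, hS, fun n X _ hX => ⟨fun h => ?_, fun h => ?_⟩⟩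
    · have h2 := ge_of_tendsto' (h 4 (by norm_num)) fun j => h1 _ _ (hX j)
      norm_num at h2
    · have h2 := ge_of_tendsto' (h 4 (by norm_num)) fun j =>
        (h1 _ _ (hX j)).trans (cycleCount_div_le (X j) 4)
      norm_num at h2
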